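/- Let $(X_i)_{i\in\mathbb N}$ be a time-homogeneous Markov chain with transition kernel $P$ on a measurable space $\mathcal E$; $\mathbb E_\nu$ denotes expectation when $X_0\sim\nu$ and $\mathbb E_x=\mathbb E_{\delta_x}$. Let $A\subset\mathcal E$ be measurable, let $\tau_A=\min\{i\ge 1: X_i\in A\}$, and assume that (i) $\mathbb P_x(\tau_A<\infty)=1$ for every $x\in\mathcal E$; (ii) $\sup_{x\in A}\mathbb E_x[\tau_A]<\infty$; (iii) for some probability measure $\psi$ and some $\lambda_0>0$, $P(x,B)\ge\lambda_0\psi(B)$ for all $x\in A$ and all measurable $B$. Let $Z_i=(X_i,Y_i)$ be the split chain on $\mathcal E\times\{0,1\}$: given $X_i$, $Y_i=0$ if $X_i\notin A$ and $Y_i\sim\mathrm{Bernoulli}(\lambda_0)$ if $X_i\in A$; then $X_{i+1}\sim P(X_i,\cdot)$ if $X_i\notin A$, $X_{i+1}\sim(1-\lambda_0)^{-1}(P(X_i,\cdot)-\lambda_0\psi)$ if $X_i\in A$ and $Y_i=0$, and $X_{i+1}\sim\psi$ if $X_i\in A$ and $Y_i=1$. Let $a=A\times\{1\}$, $\theta_a=\min\{i\ge1: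 Z_i\in a\}$ and $\alpha_0=\mathbb E_a[\theta_a]$, the expectation of $\theta_a$ when $Z_0\in a$ (it does not depend on the point of $a$). Let $\pi$ be the invariant probability measure of $P$, write $\pi(f)=\int f\,d\pi$, and let $\xi(p)=\sup_{x\in A}\mathbb E_x[\tau_A^p]\in[1,\infty]$. Then for every $p>2$ there is a finite constant $C>0$, depending only on $p$, $\lambda_0$ and $\alpha_0$, such that for every measurable $\pi$-integrable $g:\mathcal E\to\mathbb R$ with $\pi(g)=0$ and every $n\ge1$, $$\mathbb E_\pi\Big[\Big(\sum_{i=1}^n g(X_i)\Big)^2\Big]\le nC\Big(\xi(p)^2\,\pi(g^2)+\xi(p)\,\mathbb E_\pi\big[g(X_0)^2\tau_A^p\big]\Big),$$ where both sides are in $[0,\infty]$ and $\infty\cdot 0=0$. -/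

import Mathlib

open MeasureTheory ProbabilityTheory
open scoped ENNReal NNReal

universe u

namespace MarkovSplit

noncomputable section

/-! ### Homogeneous Markov chains -/

/-- The law `ℙ_ν` on `ℕ → E` of the coordinate process `X₀, X₁, X₂, …` which is a
time-homogeneous Markov chain with transition kernel `P` and initial law `X₀ ∼ ν`. -/
def chainLaw {E : Type u} [MeasurableSpace E] (P : Kernel E E) [IsMarkovKernel P]
    (ν : Measure E) : Measure (ℕ → E) :=
  Kernel.trajMeasure (X := fun _ : ℕ => E) ν
    (fun n : ℕ => P.comap (fun h : (i : Finset.Iic n) → E => h ⟨n, Finset.mem_Iic.2 le_rfl⟩)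
      (measurable_pi_apply _))

/-- The law `ℙ_x` of the chain started at `X₀ = x`. -/
def chainLawAt {E : Type u} [MeasurableSpace E] (P : Kernel E E) [IsMarkovKernel P]
    (x : E) : Measure (ℕ → E) :=
  chainLaw P (Measure.dirac x)

/-- The return time `τ_A = min {i ≥ 1 : X_i ∈ A}`, equal to `⊤` if there is no such `i`. -/
def returnTime {E : Type u} (A : Set E) (ω : ℕ → E) : ℕ∞ :=
  hittingAfter (fun (i : ℕ) (ω : ℕ → E) => ω i) A 1 ω

/-- `ξ(p) = sup_{x ∈ A} 𝔼_x[τ_A ^ p]`. -/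
def returnMoment {E : Type u} [MeasurableSpace E] (P : Kernel E E) [IsMarkovKernel P]
    (A : Set E) (p : ℝ) : ℝ≥0∞ :=
  ⨆ x ∈ A, ∫⁻ ω, (returnTime A ω : ℝ≥0∞) ^ p ∂(chainLawAt P x)

/-- The one-step minorization condition: `P(x, B) ≥ lam * ψ(B)` for all `x ∈ A` and all
measurable `B`. -/
def Minorized {E : Type u} [MeasurableSpace E] (P : Kernel E E) (A : Set E)
    (ψ : Measure E) (lam : ℝ≥0) : Prop :=
  ∀ x ∈ A, ∀ B : Set E, MeasurableSet B → (lam : ℝ≥0∞) * ψ B ≤ P x B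

/-! ### The split chain `Z_i = (X_i, Y_i)` -/

section Split

variable {E : Type u} [MeasurableSpace E] {P : Kernel E E} {A : Set E} {ψ : Measure E} {lam : ℝ≥0}

theorem Minorized.smul_le (h : Minorized P A ψ lam) {x : E} (hx : x ∈ A) :
    lam • ψ ≤ P x := by
  refine Measure.le_iff.2 fun B hB => ?_
  have hb := h x hx B hB
  rwa [Measure.smul_apply, ENNReal.smul_def, smul_eq_mul]

variable [IsMarkovKernel P] [IsProbabilityMeasure ψ]

theorem Minorized.le_one (h : Minorized P A ψ lam) {x : E} (hx : x ∈ A) : lam ≤ 1 := by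
  have := h x hx Set.univ MeasurableSet.univ
  simpa using this

/-- The residual transition `(1 - lam)⁻¹ (P(x, ·) - lam ψ)` for `x ∈ A`, and `P(x, ·)` for
`x ∉ A`. When `lam = 1` a state `(x, 0)` with `x ∈ A` is never produced, and the residual
transition is set to `P(x, ·)`. -/
def residualLaw (P : Kernel E E) (A : Set E) (ψ : Measure E) (lam : ℝ≥0) (x : E) : Measure E :=
  open Classical in
  if x ∈ A ∧ lam ≠ 1 then (1 - lam)⁻¹ • (P x - lam • ψ) else P x

theorem residualLaw_apply (h : Minorized P A ψ lam) {B : Set E} (hB : MeasurableSet B)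
    (hl : lam ≠ 1) {x : E} (hx : x ∈ A) :
    residualLaw P A ψ lam x B = ((1 - lam)⁻¹ : ℝ≥0) * (P x B - lam * ψ B) := by
  rw [residualLaw, if_pos ⟨hx, hl⟩, Measure.smul_apply, Measure.sub_apply hB (h.smul_le hx),
    Measure.smul_apply, ENNReal.smul_def, ENNReal.smul_def, smul_eq_mul, smul_eq_mul]

theorem measurable_residualLaw (hA : MeasurableSet A) (h : Minorized P A ψ lam) :
    Measurable (residualLaw P A ψ lam) := by
  classical
  refine Measure.measurable_of_measurable_coe _ fun B hB => ?_
  by_cases hl : lam = 1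
  · have : (fun x => residualLaw P A ψ lam x B) = fun x => P x B := by
      funext x; simp [residualLaw, hl]
    rw [this]; exact P.measurable_coe hB
  · have : (fun x => residualLaw P A ψ lam x B)
        = A.piecewise (fun x => ((1 - lam)⁻¹ : ℝ≥0) * (P x B - lam * ψ B)) (fun x => P x B) := by
      funext x
      by_cases hx : x ∈ A
      · rw [Set.piecewise_eq_of_mem _ _ _ hx, residualLaw_apply h hB hl hx]
      · rw [Set.piecewise_eq_of_notMem _ _ _ hx]; simp [residualLaw, hx]
    rw [this]
    exact Measurable.piecewise hA
      (((P.measurable_coe hB).sub_const _).const_mul _) (P.measurable_coe hB)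

/-- The residual transition as a kernel. -/
def residualKernel (hA : MeasurableSet A) (h : Minorized P A ψ lam) : Kernel E E where
  toFun := residualLaw P A ψ lam
  measurable' := measurable_residualLaw hA h

instance (hA : MeasurableSet A) (h : Minorized P A ψ lam) :
    IsMarkovKernel (residualKernel hA h) := by
  refine ⟨fun x => ⟨?_⟩⟩
  change residualLaw P A ψ lam x Set.univ = 1
  by_cases hx : x ∈ A ∧ lam ≠ 1
  · rw [residualLaw_apply h MeasurableSet.univ hx.2 hx.1]
    have h1 : lam < 1 := lt_of_le_of_ne (h.le_one hx.1) hx.2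
    have h2 : (1 - lam) ≠ 0 := (tsub_pos_of_lt h1).ne'
    have h3 : (1 : ℝ≥0∞) - lam = ((1 - lam : ℝ≥0) : ℝ≥0∞) := by push_cast; rfl
    rw [measure_univ, measure_univ, mul_one, h3, ← ENNReal.coe_mul, inv_mul_cancel₀ h2]
    rfl
  · rw [residualLaw, if_neg hx, measure_univ]

/-- The atom `a = A × {1}` of the split chain. -/
def atom (A : Set E) : Set (E × Bool) := A ×ˢ {true}

theorem measurableSet_atom (hA : MeasurableSet A) : MeasurableSet (atom A) :=
  hA.prod (measurableSet_singleton true)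

/-- Generation of `X_{i+1}` given `(X_i, Y_i) = (x, y)`: from `ψ` if `x ∈ A` and `y = 1`, and
from the residual transition otherwise (which is `P(x, ·)` if `x ∉ A`). -/
def moveKernel (hA : MeasurableSet A) (h : Minorized P A ψ lam) : Kernel (E × Bool) E :=
  open Classical in
  Kernel.piecewise (measurableSet_atom hA)
    (Kernel.const (E × Bool) ψ)
    ((residualKernel hA h).comap Prod.fst measurable_fst)

instance (hA : MeasurableSet A) (h : Minorized P A ψ lam) :
    IsMarkovKernel (moveKernel hA h) := by
  unfold moveKernel; infer_instance

/-- Generation of `Y_i` given `X_i = x`: Bernoulli with parameter `lam` if `x ∈ A`, and `0` if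
`x ∉ A`. -/
def labelKernel (hA : MeasurableSet A) (lam : ℝ≥0) : Kernel E Bool :=
  open Classical in
  Kernel.piecewise hA
    (Kernel.const E (lam • Measure.dirac true + (1 - lam) • Measure.dirac false))
    (Kernel.const E (Measure.dirac false))

theorem isMarkovKernel_labelKernel (hA : MeasurableSet A) (h : Minorized P A ψ lam) :
    IsMarkovKernel (labelKernel hA lam) := by
  refine ⟨fun x => ⟨?_⟩⟩
  classical
  simp only [labelKernel, Kernel.piecewise_apply]
  split_ifs with hx
  · have h3 : lam + (1 - lam) = 1 := add_tsub_cancel_of_le (h.le_one hx)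
    simp only [Kernel.const_apply, Measure.add_apply, Measure.smul_apply, measure_univ,
      ENNReal.smul_def, smul_eq_mul, mul_one, ← ENNReal.coe_add, h3, ENNReal.coe_one]
  · simp

/-- The transition kernel of the split chain: generate `X_{i+1}` from `(X_i, Y_i)`, then
`Y_{i+1}` from `X_{i+1}`. -/
def splitKernel (hA : MeasurableSet A) (h : Minorized P A ψ lam) :
    Kernel (E × Bool) (E × Bool) :=
  moveKernel hA h ⊗ₖ Kernel.prodMkLeft (E × Bool) (labelKernel hA lam)

instance (hA : MeasurableSet A) (h : Minorized P A ψ lam) :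
    IsMarkovKernel (splitKernel hA h) := by
  have := isMarkovKernel_labelKernel hA h
  unfold splitKernel; infer_instance

/-- The mean return time `α₀ = 𝔼_a[θ_a]` of the split chain to its atom,
`θ_a = min {i ≥ 1 : Z_i ∈ a}`. As the transition from `z ∈ a` does not depend on `z`, neither does
`𝔼_z[θ_a]`, and the supremum is over a constant family. -/
def atomMeanReturn (hA : MeasurableSet A) (h : Minorized P A ψ lam) : ℝ≥0∞ :=
  ⨆ z ∈ atom A, ∫⁻ ω, (returnTime (atom A) ω : ℝ≥0∞) ∂(chainLawAt (splitKernel hA h) z)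

end Split

end

end MarkovSplit

open MarkovSplit

/-! Write `Q` for the kernel `killed` (`P` with the part `lam • ψ` removed on leaving `A`), `R` for
`avoid` (`P` killed on entering `A`) and `ξ` for `ξ(p)`. By stationarity the second moment is at
most `2n` times any nonnegative bound, uniform in `m ≤ n`, for `∑ k < m, ∫ g · P^k g dπ`. Splitting
at the first regeneration (`sum_integral_pow`), `∑ k < m, P^k g = ∑ k < m, Q^k g + ∑ j < m, ψ(P^j g)
(1 - Q^(m-1-j) 1)`. Integrated against `g dπ`, the `1` disappears because `π(g) = 0`, and only
survival probabilities `Q^k 1` remain. The factors satisfy `|ψ(P^j g)| ≤ (ξ / lam) π|g|`, because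
`lam π(A) ψ ≤ π` and Kac's formula gives `1 ≤ π(A) ξ`.

Two series are left: `∑ ∫ |g| Q^k |g| dπ` and `(ξ / lam) π|g| ∑ ∫ |g| Q^k 1 dπ`. For the first,
Young's inequality with weights `(k+1)^q`, `q = p - 1`, whose inverses are summable because `p > 2`,
leaves `∫ g² ∑ (k+1)^q Q^k 1 dπ`. This moment of the lifetime under `Q` is compared with that under
`R` in `exists_tsum_polyWeight_killed_le`: each departure from `A` survives with probability `1 -
lam`, which yields a contraction. Finally `∑ (k+1)^q R^k 1 (x)` is at most `𝔼_x[τ_A^p]`. The second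
series already carries a factor `ξ`, so the weighted bound for `Q` would give `ξ³`. Instead `∑ Q^k 1
≤ ξ / lam + ∑ R^k 1` (`tsum_killed_pow_le`) is applied before Young's inequality. All this is done
for bounded `g`; truncation and Fatou's lemma give the general case. -/

namespace MarkovSplit

/-! ### Path law and powers of kernels -/

section Path

variable {E : Type u} [MeasurableSpace E] (P : Kernel E E) [IsMarkovKernel P]
  (ν : Measure E) [IsProbabilityMeasure ν]

instance : IsProbabilityMeasure (chainLaw P ν) := by
  unfold chainLaw; infer_instance

omit [IsProbabilityMeasure ν] in
theorem map_zero_chainLaw : (chainLaw P ν).map (fun ω => ω 0) = ν := by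
  have h : (fun ω : ℕ → E => ω 0)
      = (MeasurableEquiv.piUnique (fun _ : Finset.Iic (0 : ℕ) => E)) ∘
        (Preorder.frestrictLe (π := fun _ : ℕ => E) 0) := by
    funext ω; rfl
  rw [h, ← Measure.map_map (by fun_prop) (by fun_prop), chainLaw, Kernel.trajMeasure,
    Measure.map_comp _ _ (by fun_prop), Kernel.traj_map_frestrictLe, Kernel.partialTraj_self,
    Measure.id_comp, Measure.map_map (by fun_prop) (by fun_prop)]
  exact Measure.map_id

variable {P ν}

/-- The Markov property. All finite-dimensional computations below rest on it and on
`map_zero_chainLaw`. -/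
theorem lintegral_chainLaw_succ (n : ℕ) {F : ((i : Finset.Iic n) → E) → ℝ≥0∞}
    (hF : Measurable F) {h : E → ℝ≥0∞} (hh : Measurable h) :
    ∫⁻ ω, F (Preorder.frestrictLe n ω) * h (ω (n + 1)) ∂(chainLaw P ν)
      = ∫⁻ ω, F (Preorder.frestrictLe n ω) * ∫⁻ y, h y ∂(P (ω n)) ∂(chainLaw P ν) := by
  have key := Kernel.map_frestrictLe_trajMeasure_compProd_eq_map_trajMeasure (X := fun _ : ℕ => E)
    (μ₀ := ν) (κ := fun n : ℕ => P.comap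
      (fun h : (i : Finset.Iic n) → E => h ⟨n, Finset.mem_Iic.2 le_rfl⟩)
      (measurable_pi_apply _)) (a := n)
  have hm : Measurable fun z : ((i : Finset.Iic n) → E) × E => F z.1 * h z.2 := by fun_prop
  have h2 := congrArg (fun μ => ∫⁻ z, F z.1 * h z.2 ∂μ) key
  beta_reduce at h2
  rw [Measure.lintegral_compProd hm, lintegral_map hm (by fun_prop)] at h2
  rw [chainLaw, ← h2, lintegral_map]
  · refine lintegral_congr fun ω => ?_
    exact lintegral_const_mul (F (Preorder.frestrictLe n ω)) hh
  · exact Measurable.lintegral_kernel_prod_right (κ := P.comap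
      (fun h : (i : Finset.Iic n) → E => h ⟨n, Finset.mem_Iic.2 le_rfl⟩)
      (measurable_pi_apply _)) hm
  · fun_prop

theorem lintegral_pow_succ' {κ : Kernel E E} {h : E → ℝ≥0∞} (hh : Measurable h) (k : ℕ) (x : E) :
    ∫⁻ y, h y ∂((κ ^ (k + 1)) x) = ∫⁻ z, ∫⁻ y, h y ∂(κ z) ∂((κ ^ k) x) := by
  rw [pow_succ']
  exact Kernel.lintegral_comp κ (κ ^ k) x hh

theorem lintegral_pow_succ {κ : Kernel E E} {h : E → ℝ≥0∞} (hh : Measurable h) (k : ℕ) (x : E) :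
    ∫⁻ y, h y ∂((κ ^ (k + 1)) x) = ∫⁻ z, ∫⁻ y, h y ∂((κ ^ k) z) ∂(κ x) := by
  rw [pow_succ]
  exact Kernel.lintegral_comp (κ ^ k) κ x hh

instance (k : ℕ) : IsMarkovKernel (P ^ k) := by
  induction k with
  | zero => rw [pow_zero]; exact inferInstanceAs (IsMarkovKernel (Kernel.id : Kernel E E))
  | succ k ih => rw [pow_succ]; exact inferInstanceAs (IsMarkovKernel ((P ^ k) ∘ₖ P))

theorem lintegral_pow_zero {κ : Kernel E E} {h : E → ℝ≥0∞} (hh : Measurable h) (x : E) :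
    ∫⁻ y, h y ∂((κ ^ 0) x) = h x := by
  rw [pow_zero]
  change ∫⁻ y, h y ∂((Kernel.id : Kernel E E) x) = h x
  rw [Kernel.id_apply, lintegral_dirac' _ hh]

omit [MeasurableSpace E] in
theorem lt_returnTime_iff {A : Set E} {ω : ℕ → E} {k : ℕ} :
    (k : ℕ∞) < returnTime A ω ↔ ∀ i, 1 ≤ i → i ≤ k → ω i ∉ A := by
  rw [← not_le, returnTime]
  have := hittingAfter_le_iff (u := fun (i : ℕ) (ω : ℕ → E) => ω i) (s := A) (n := 1) (i := k)
    (ω := ω)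
  erw [this]
  simp only [Set.mem_Icc, not_exists, not_and, and_imp]

/-- The event `k < τ_A`. -/
def lateReturn (A : Set E) (k : ℕ) : Set (ℕ → E) := {ω | (k : ℕ∞) < returnTime A ω}

omit [MeasurableSpace E] in
theorem mem_lateReturn {A : Set E} {ω : ℕ → E} {k : ℕ} :
    ω ∈ lateReturn A k ↔ (k : ℕ∞) < returnTime A ω := Iff.rfl

omit [MeasurableSpace E] in
theorem mem_lateReturn_iff {A : Set E} {ω : ℕ → E} {k : ℕ} :
    ω ∈ lateReturn A k ↔ ∀ i, 1 ≤ i → i ≤ k → ω i ∉ A := lt_returnTime_iff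

theorem measurableSet_lateReturn {A : Set E} (hA : MeasurableSet A) (k : ℕ) :
    MeasurableSet (lateReturn A k) := by
  have : lateReturn A k = {ω : ℕ → E | ∀ i, 1 ≤ i → i ≤ k → ω i ∉ A} := by
    ext ω; exact mem_lateReturn_iff
  rw [this]
  simp only [Set.ofPred_forall]
  exact MeasurableSet.iInter fun i => MeasurableSet.iInter fun _ => MeasurableSet.iInter fun _ =>
    (measurable_pi_apply i hA).compl

/-- The kernel `P` killed upon entering `A`. -/
noncomputable def avoid (P : Kernel E E) {A : Set E} (hA : MeasurableSet A) : Kernel E E :=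
  P.restrict hA.compl

/-- `avoid` restricts the target of each step, so `X_0` may lie in `A`, in agreement with `τ_A ≥ 1`.
The induction peels off the last step by the Markov property. The factor `f (ω 0)` will be `|g|` or
`g²`. -/
theorem lintegral_avoid_pow {A : Set E} (hA : MeasurableSet A) {f : E → ℝ≥0∞} (hf : Measurable f)
    (k : ℕ) {h : E → ℝ≥0∞} (hh : Measurable h) :
    ∫⁻ ω, f (ω 0) * (lateReturn A k).indicator (fun ω => h (ω k)) ω ∂(chainLaw P ν)
      = ∫⁻ x, f x * ∫⁻ y, h y ∂((avoid P hA ^ k) x) ∂ν := by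
  induction k generalizing h with
  | zero =>
    simp only [lintegral_pow_zero hh]
    conv_rhs => rw [← map_zero_chainLaw P ν]
    rw [lintegral_map (by fun_prop) (by fun_prop)]
    refine lintegral_congr fun ω => ?_
    rw [Set.indicator_of_mem]
    rw [mem_lateReturn_iff]
    intro i h1 h2; omega
  | succ k ih =>
    have hR : Measurable fun z => ∫⁻ y, h y ∂(avoid P hA z) := hh.lintegral_kernel
    simp only [lintegral_pow_succ' hh]
    rw [← ih hR]
    -- The event `k < τ_A` depends on the coordinates up to `k` only, so its indicator can be part
    -- of the past in the Markov property.
    have hS : MeasurableSet {y : (i : Finset.Iic k) → E | ∀ i, 1 ≤ i.1 → y i ∉ A} := by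
      simp only [Set.ofPred_forall]
      exact MeasurableSet.iInter fun i => MeasurableSet.iInter fun _ =>
        (measurable_pi_apply i hA).compl
    have hF : Measurable fun y : (i : Finset.Iic k) → E =>
        f (y ⟨0, by simp⟩) * {y : (i : Finset.Iic k) → E | ∀ i, 1 ≤ i.1 → y i ∉ A}.indicator 1 y :=
      (hf.comp (measurable_pi_apply _)).mul (measurable_one.indicator hS)
    have hi : ∀ ω : ℕ → E, {y : (i : Finset.Iic k) → E | ∀ i, 1 ≤ i.1 → y i ∉ A}.indicator
        (1 : ((i : Finset.Iic k) → E) → ℝ≥0∞) (Preorder.frestrictLe (π := fun _ => E) k ω)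
          = (lateReturn A k).indicator 1 ω := by
      intro ω
      have h1 : Preorder.frestrictLe (π := fun _ => E) k ω ∈
          {y : (i : Finset.Iic k) → E | ∀ i, 1 ≤ i.1 → y i ∉ A} ↔ ω ∈ lateReturn A k := by
        rw [mem_lateReturn_iff, Set.mem_ofPred_eq]
        exact ⟨fun h i h1 h2 => h ⟨i, Finset.mem_Iic.2 h2⟩ h1,
          fun h i h1 => h i.1 h1 (Finset.mem_Iic.1 i.2)⟩
      by_cases h2 : ω ∈ lateReturn A k
      · rw [Set.indicator_of_mem (h1.2 h2), Set.indicator_of_mem h2]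
        rfl
      · rw [Set.indicator_of_notMem h2, Set.indicator_of_notMem (mt h1.1 h2)]
    have := lintegral_chainLaw_succ (P := P) (ν := ν) k hF (hh.indicator hA.compl)
    simp only [hi] at this
    refine Eq.trans ?_ (this.trans ?_)
    · refine lintegral_congr fun ω => ?_
      simp only [Preorder.frestrictLe_apply, mul_assoc]
      congr 1
      by_cases h1 : ω ∈ lateReturn A k
      · rw [Set.indicator_of_mem h1, Pi.one_apply, one_mul]
        rw [mem_lateReturn_iff] at h1
        by_cases h2 : ω (k + 1) ∈ A
        · rw [Set.indicator_of_notMem, Set.indicator_of_notMem (s := Aᶜ) (by simpa using h2)]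
          rw [mem_lateReturn_iff]
          grind
        · rw [Set.indicator_of_mem, Set.indicator_of_mem (s := Aᶜ) h2]
          rw [mem_lateReturn_iff]
          grind
      · rw [Set.indicator_of_notMem, Set.indicator_of_notMem h1, zero_mul]
        rw [mem_lateReturn_iff] at h1 ⊢
        grind
    · refine lintegral_congr fun ω => ?_
      simp only [Preorder.frestrictLe_apply, mul_assoc]
      congr 1
      by_cases h1 : ω ∈ lateReturn A k
      · rw [Set.indicator_of_mem h1, Set.indicator_of_mem h1,
          avoid, Kernel.restrict_apply, lintegral_indicator hA.compl, Pi.one_apply, one_mul]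
      · rw [Set.indicator_of_notMem h1, Set.indicator_of_notMem h1, zero_mul]

theorem lintegral_chainLaw_pair {f h : E → ℝ≥0∞} (hf : Measurable f) (i k : ℕ)
    (hh : Measurable h) :
    ∫⁻ ω, f (ω i) * h (ω (i + k)) ∂(chainLaw P ν)
      = ∫⁻ ω, f (ω i) * ∫⁻ y, h y ∂((P ^ k) (ω i)) ∂(chainLaw P ν) := by
  induction k generalizing h with
  | zero => simp only [lintegral_pow_zero hh, add_zero]
  | succ k ih =>
    have hR : Measurable fun z => ∫⁻ y, h y ∂(P z) := hh.lintegral_kernel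
    simp only [lintegral_pow_succ' hh]
    rw [← ih hR]
    have hF : Measurable fun y : (j : Finset.Iic (i + k)) → E => f (y ⟨i, by simp⟩) :=
      hf.comp (measurable_pi_apply _)
    exact lintegral_chainLaw_succ (P := P) (ν := ν) (i + k) hF hh

theorem map_chainLaw_of_invariant (hν : Kernel.Invariant P ν) (i : ℕ) :
    (chainLaw P ν).map (fun ω => ω i) = ν := by
  induction i with
  | zero => exact map_zero_chainLaw P ν
  | succ n ih =>
    refine Measure.ext_of_lintegral _ fun f hf => ?_
    rw [lintegral_map hf (by fun_prop)]
    have := lintegral_chainLaw_succ (P := P) (ν := ν) n (F := fun _ => 1) measurable_const hf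
    simp only [one_mul] at this
    rw [this]
    have h2 : Measurable fun z => ∫⁻ y, f y ∂(P z) := hf.lintegral_kernel
    rw [← lintegral_map (f := fun z => ∫⁻ y, f y ∂(P z)) (g := fun ω : ℕ → E => ω n) h2
      (by fun_prop), ih, ← Measure.lintegral_bind (P.aemeasurable) hf.aemeasurable, hν.def]

theorem map_pair_chainLaw (hν : Kernel.Invariant P ν) (i k : ℕ) :
    (chainLaw P ν).map (fun ω => (ω i, ω (i + k))) = ν ⊗ₘ (P ^ k) := by
  refine Measure.ext_prod fun {s} {t} hs ht => ?_
  rw [Measure.map_apply (by fun_prop) (hs.prod ht), Measure.compProd_apply_prod hs ht]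
  have key := lintegral_chainLaw_pair (P := P) (ν := ν) (f := s.indicator 1) (h := t.indicator 1)
    (measurable_one.indicator hs) i k (measurable_one.indicator ht)
  have h2 : Measurable fun z => s.indicator (1 : E → ℝ≥0∞) z *
      ∫⁻ y, t.indicator 1 y ∂((P ^ k) z) :=
    (measurable_one.indicator hs).mul (measurable_one.indicator ht).lintegral_kernel
  rw [← lintegral_map (f := fun z => s.indicator (1 : E → ℝ≥0∞) z *
      ∫⁻ y, t.indicator 1 y ∂((P ^ k) z)) (g := fun ω : ℕ → E => ω i) h2 (by fun_prop),
    map_chainLaw_of_invariant hν] at key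
  have hpre : MeasurableSet ((fun ω : ℕ → E => (ω i, ω (i + k))) ⁻¹' s ×ˢ t) :=
    (by fun_prop : Measurable fun ω : ℕ → E => (ω i, ω (i + k))) (hs.prod ht)
  rw [← lintegral_indicator_one hpre, ← lintegral_indicator hs]
  refine Eq.trans (lintegral_congr fun ω => ?_) (key.trans (lintegral_congr fun x => ?_))
  · by_cases h1 : ω i ∈ s <;> by_cases h3 : ω (i + k) ∈ t <;> simp [Set.indicator, h1, h3]
  · by_cases h1 : x ∈ s <;> simp [h1, lintegral_indicator_one ht]

end Path

/-! ### Killing at the entrance to `A` and killing at regeneration -/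

section Killed

variable {E : Type u} [MeasurableSpace E] {P : Kernel E E} {A : Set E} {ψ : Measure E} {lam : ℝ≥0}

section Avoid

theorem avoid_pow_zero (hA : MeasurableSet A) (x : E) : (avoid P hA ^ 0) x Set.univ = 1 := by
  have := lintegral_pow_zero (κ := avoid P hA) (h := fun _ => 1) measurable_const x
  simpa using this

theorem avoid_pow_succ (hA : MeasurableSet A) (k : ℕ) (x : E) :
    (avoid P hA ^ (k + 1)) x Set.univ
      = ∫⁻ y in Aᶜ, (avoid P hA ^ k) y Set.univ ∂(P x) := by
  have := lintegral_pow_succ (κ := avoid P hA) (h := fun _ => 1) measurable_const k x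
  simp only [lintegral_const, one_mul] at this
  rw [this]
  conv_lhs => rw [avoid, Kernel.restrict_apply]
  rfl

theorem measurable_pow_univ (κ : Kernel E E) (k : ℕ) :
    Measurable fun x => (κ ^ k) x Set.univ :=
  Kernel.measurable_coe _ MeasurableSet.univ

/-- Weighted sums of the tails of the return time satisfy a one-step equation. -/
theorem tsum_avoid_pow (hA : MeasurableSet A) (a : ℕ → ℝ≥0∞) (s : ℕ) (x : E) :
    ∑' k, a (k + s) * (avoid P hA ^ k) x Set.univ
      = a s + ∫⁻ y in Aᶜ, ∑' k, a (k + (s + 1)) * (avoid P hA ^ k) y Set.univ ∂(P x) := by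
  rw [tsum_eq_zero_add' ENNReal.summable, avoid_pow_zero, mul_one, zero_add, lintegral_tsum
    fun k => ((measurable_pow_univ _ k).const_mul _).aemeasurable]
  congr 1
  refine tsum_congr fun k => ?_
  rw [avoid_pow_succ, lintegral_const_mul _ (measurable_pow_univ _ k), add_right_comm, add_assoc]

end Avoid

variable [IsMarkovKernel P] [IsProbabilityMeasure ψ]

/-- The kernel `P` killed with rate `lam` upon leaving `A`: it removes the regeneration part
`lam • ψ` of the transitions out of `A`. -/
noncomputable def killed (hA : MeasurableSet A) (h : Minorized P A ψ lam) : Kernel E E where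
  toFun x := open Classical in if x ∈ A then P x - lam • ψ else P x
  measurable' := by
    classical
    refine Measure.measurable_of_measurable_coe _ fun B hB => ?_
    have : (fun x => (if x ∈ A then P x - lam • ψ else P x) B)
        = A.piecewise (fun x => P x B - lam * ψ B) (fun x => P x B) := by
      funext x
      by_cases hx : x ∈ A
      · rw [Set.piecewise_eq_of_mem _ _ _ hx, if_pos hx, Measure.sub_apply hB (h.smul_le hx),
          Measure.smul_apply, ENNReal.smul_def, smul_eq_mul]
      · rw [Set.piecewise_eq_of_notMem _ _ _ hx, if_neg hx]
    rw [this]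
    exact Measurable.piecewise hA ((P.measurable_coe hB).sub_const _) (P.measurable_coe hB)

variable (hA : MeasurableSet A) (h : Minorized P A ψ lam)

omit [IsMarkovKernel P] in
theorem killed_of_notMem {x : E} (hx : x ∉ A) : killed hA h x = P x := by
  classical
  change (if x ∈ A then P x - lam • ψ else P x) = P x
  rw [if_neg hx]

omit [IsMarkovKernel P] in
theorem killed_add {x : E} (hx : x ∈ A) : killed hA h x + lam • ψ = P x := by
  classical
  change (if x ∈ A then P x - lam • ψ else P x) + lam • ψ = P x
  rw [if_pos hx]
  exact Measure.sub_add_cancel_of_le (h.smul_le hx)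

omit [IsMarkovKernel P] in
theorem killed_le (x : E) : killed hA h x ≤ P x := by
  by_cases hx : x ∈ A
  · rw [← killed_add hA h hx]; exact Measure.le_add_right le_rfl
  · rw [killed_of_notMem hA h hx]

theorem killed_univ {x : E} (hx : x ∈ A) : killed hA h x Set.univ = 1 - lam := by
  have := congrArg (fun μ => μ Set.univ) (killed_add hA h hx)
  simp only [Measure.add_apply, Measure.smul_apply, measure_univ, ENNReal.smul_def,
    smul_eq_mul, mul_one] at this
  rw [← this, ENNReal.add_sub_cancel_right ENNReal.coe_ne_top]

theorem killed_univ_le (x : E) : killed hA h x Set.univ ≤ 1 :=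
  (killed_le hA h x Set.univ).trans prob_le_one

omit [IsMarkovKernel P] in
theorem killed_pow_zero (x : E) : (killed hA h ^ 0) x Set.univ = 1 := by
  have := lintegral_pow_zero (κ := killed hA h) (h := fun _ => 1) measurable_const x
  simpa using this

omit [IsMarkovKernel P] in
theorem killed_pow_succ (k : ℕ) (x : E) :
    (killed hA h ^ (k + 1)) x Set.univ
      = ∫⁻ y, (killed hA h ^ k) y Set.univ ∂(killed hA h x) := by
  have := lintegral_pow_succ (κ := killed hA h) (h := fun _ => 1) measurable_const k x
  simpa only [lintegral_const, one_mul] using this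

theorem killed_pow_univ_le (k : ℕ) (x : E) : (killed hA h ^ k) x Set.univ ≤ 1 := by
  induction k generalizing x with
  | zero => rw [killed_pow_zero]
  | succ k ih =>
    rw [killed_pow_succ]
    calc _ ≤ ∫⁻ _, 1 ∂(killed hA h x) := lintegral_mono fun y => ih y
      _ ≤ 1 := by rw [lintegral_one]; exact killed_univ_le hA h x

omit [IsMarkovKernel P] in
theorem sum_killed_pow_succ (a : ℕ → ℝ≥0∞) (s n : ℕ) (x : E) :
    ∑ k ∈ Finset.range (n + 1), a (k + s) * (killed hA h ^ k) x Set.univ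
      = a s + ∫⁻ y, ∑ k ∈ Finset.range n, a (k + (s + 1)) * (killed hA h ^ k) y Set.univ
          ∂(killed hA h x) := by
  rw [Finset.sum_range_succ', killed_pow_zero, mul_one, zero_add, lintegral_finsetSum _
    fun k _ => (measurable_pow_univ _ k).const_mul _, add_comm]
  congr 1
  refine Finset.sum_congr rfl fun k _ => ?_
  rw [killed_pow_succ, lintegral_const_mul _ (measurable_pow_univ _ k), add_right_comm, add_assoc]

omit [IsMarkovKernel P] in
/-- One step of the killed chain, from bounds after this step. -/
theorem lintegral_killed_le (a : ℕ → ℝ≥0∞) (s : ℕ) (c K : ℝ≥0∞) {f : E → ℝ≥0∞}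
    (hfA : ∀ y ∈ A, f y ≤ K)
    (hf : ∀ y, f y ≤ K + (1 + c) * ∑' k, a (k + (s + 1)) * (avoid P hA ^ k) y Set.univ) (x : E) :
    ∫⁻ y, f y ∂(killed hA h x) ≤ K * killed hA h x Set.univ
      + (1 + c) * ∫⁻ y in Aᶜ, ∑' k, a (k + (s + 1)) * (avoid P hA ^ k) y Set.univ ∂(P x) := by
  have hm : Measurable fun y => ∑' k, a (k + (s + 1)) * (avoid P hA ^ k) y Set.univ :=
    Measurable.tsum fun k => (measurable_pow_univ _ k).const_mul _
  calc ∫⁻ y, f y ∂(killed hA h x)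
      ≤ ∫⁻ y, (K + Aᶜ.indicator (fun y => (1 + c) *
          ∑' k, a (k + (s + 1)) * (avoid P hA ^ k) y Set.univ) y) ∂(killed hA h x) := by
        refine lintegral_mono fun y => ?_
        by_cases hy : y ∈ A
        · rw [Set.indicator_of_notMem (by simpa using hy), add_zero]; exact hfA y hy
        · rw [Set.indicator_of_mem (s := Aᶜ) hy]; exact hf y
    _ = K * killed hA h x Set.univ + ∫⁻ y in Aᶜ, (1 + c) *
          ∑' k, a (k + (s + 1)) * (avoid P hA ^ k) y Set.univ ∂(killed hA h x) := by
        rw [lintegral_add_left measurable_const, lintegral_const, lintegral_indicator hA.compl]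
    _ ≤ _ := by
        gcongr
        rw [lintegral_const_mul _ hm]
        gcongr
        exact killed_le hA h x

/-- Extends a bound on `A` to all starting points by following the chain until it enters `A`. A step
before that moves the shift from `s` to `s + 1`; it contributes `a s` itself and raises the bound
awaiting in `A` by `c * a s`, whence the factor `1 + c`. -/
theorem sum_killed_pow_le (a : ℕ → ℝ≥0∞) (M c : ℝ≥0∞) (N : ℕ)
    (H : ∀ n ≤ N, ∀ s, ∀ y ∈ A, ∑ k ∈ Finset.range n, a (k + s) * (killed hA h ^ k) y Set.univ
      ≤ M + c * ∑ j ∈ Finset.range s, a j) (n : ℕ) (hn : n ≤ N) (s : ℕ) (x : E) :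
    ∑ k ∈ Finset.range n, a (k + s) * (killed hA h ^ k) x Set.univ
      ≤ M + c * ∑ j ∈ Finset.range s, a j
        + (1 + c) * ∑' k, a (k + s) * (avoid P hA ^ k) x Set.univ := by
  induction n generalizing s x with
  | zero => simp
  | succ n ih =>
    rw [sum_killed_pow_succ, tsum_avoid_pow]
    have := lintegral_killed_le hA h a s c (M + c * ∑ j ∈ Finset.range (s + 1), a j)
      (H n (by omega) (s + 1)) (ih (by omega) (s + 1)) x
    refine (add_le_add_right this (a s)).trans ?_
    calc _ ≤ a s + ((M + c * ∑ j ∈ Finset.range (s + 1), a j) * 1 + (1 + c) *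
          ∫⁻ y in Aᶜ, ∑' k, a (k + (s + 1)) * (avoid P hA ^ k) y Set.univ ∂(P x)) := by
          gcongr; exact killed_univ_le hA h x
      _ = _ := by rw [Finset.sum_range_succ]; ring

/-- The first step out of `A` survives with probability `1 - lam`, so `M` comes back multiplied by
`1 - lam`. This contraction closes the inductions on the truncation level `N`; since these start
from the empty sum, no finiteness is needed beforehand. -/
theorem sum_killed_pow_le_of_mem (a : ℕ → ℝ≥0∞) (M c : ℝ≥0∞) (N : ℕ)
    (H : ∀ n ≤ N, ∀ s, ∀ y ∈ A, ∑ k ∈ Finset.range n, a (k + s) * (killed hA h ^ k) y Set.univ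
      ≤ M + c * ∑ j ∈ Finset.range s, a j) {x : E} (hx : x ∈ A) :
    ∑ k ∈ Finset.range (N + 1), a k * (killed hA h ^ k) x Set.univ
      ≤ (1 - lam) * M + (1 + c) * ∑' k, a k * (avoid P hA ^ k) x Set.univ := by
  have h1 := sum_killed_pow_succ hA h a 0 N x
  have h2 := tsum_avoid_pow (P := P) hA a 0 x
  have h3 := lintegral_killed_le hA h a 0 c (M + c * ∑ j ∈ Finset.range 1, a j)
      (H N le_rfl 1) (sum_killed_pow_le hA h a M c N H N le_rfl 1) x
  simp only [add_zero] at h1 h2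
  rw [h1, h2]
  refine (add_le_add_right h3 (a 0)).trans ?_
  rw [killed_univ hA h hx, Finset.sum_range_one]
  calc _ = a 0 + ((1 - lam) * M + (1 - lam) * (c * a 0) + (1 + c) *
          ∫⁻ y in Aᶜ, ∑' k, a (k + (0 + 1)) * (avoid P hA ^ k) y Set.univ ∂(P x)) := by ring
    _ ≤ a 0 + ((1 - lam) * M + 1 * (c * a 0) + (1 + c) *
          ∫⁻ y in Aᶜ, ∑' k, a (k + (0 + 1)) * (avoid P hA ^ k) y Set.univ ∂(P x)) := by
        gcongr; exact tsub_le_self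
    _ = _ := by ring

/-- Mean lifetime of the killed chain started in `A`. -/
theorem sum_killed_pow_le_div (hlam : 0 < lam) {ξ : ℝ≥0∞}
    (hξ : ∀ y ∈ A, ∑' k, (avoid P hA ^ k) y Set.univ ≤ ξ) (N : ℕ) :
    ∀ n ≤ N, ∀ y ∈ A, ∑ k ∈ Finset.range n, (killed hA h ^ k) y Set.univ ≤ ξ / lam := by
  induction N with
  | zero => intro n hn y _; simp [Nat.le_zero.1 hn]
  | succ N ih =>
    intro n hn y hy
    have := sum_killed_pow_le_of_mem hA h (fun _ => 1) (ξ / lam) 0 N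
      (by intro n hn s y hy; simpa using ih n hn y hy) hy
    simp only [one_mul, add_zero] at this
    refine (Finset.sum_le_sum_of_subset (Finset.range_mono hn)).trans (this.trans ?_)
    refine (add_le_add_right (hξ y hy) _).trans ?_
    have hl : (lam : ℝ≥0∞) ≠ 0 := by simpa using hlam.ne'
    have h1 : (lam : ℝ≥0∞) ≤ 1 := by exact_mod_cast h.le_one hy
    -- `ξ / lam` is the fixed point of `K ↦ (1 - lam) K + ξ`.
    calc (1 - lam) * (ξ / lam) + ξ = (1 - lam) * (ξ / lam) + lam * (ξ / lam) := by
          rw [ENNReal.mul_div_cancel hl ENNReal.coe_ne_top]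
      _ = ξ / lam := by rw [← add_mul, tsub_add_cancel_of_le h1, one_mul]
      _ ≤ ξ / lam := le_rfl

/-- After the entrance to `A`, the mean remaining lifetime is at most `ξ / lam`. The bound is of
first order in `ξ`, which keeps the final estimate at order `ξ ^ 2`. -/
theorem tsum_killed_pow_le (hlam : 0 < lam) {ξ : ℝ≥0∞}
    (hξ : ∀ y ∈ A, ∑' k, (avoid P hA ^ k) y Set.univ ≤ ξ) (x : E) :
    ∑' k, (killed hA h ^ k) x Set.univ ≤ ξ / lam + ∑' k, (avoid P hA ^ k) x Set.univ := by
  refine ENNReal.tsum_le_of_sum_range_le fun N => ?_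
  have := sum_killed_pow_le hA h (fun _ => 1) (ξ / lam) 0 N
    (by intro n hn s y hy; simpa using sum_killed_pow_le_div hA h hlam hξ N n hn y hy) N le_rfl 0 x
  simpa using this

end Killed

/-! ### Polynomial weights -/

/-- The weights `(k + 1) ^ q`. -/
noncomputable def polyWeight (q : ℝ) (k : ℕ) : ℝ≥0 := ((k : ℝ≥0) + 1) ^ q

theorem one_le_polyWeight {q : ℝ} (hq : 0 ≤ q) (k : ℕ) : 1 ≤ polyWeight q k :=
  NNReal.one_le_rpow (by simp) hq

/-- Either the shift is small compared with `k + 1` and costs a factor `(1 + δ) ^ q ≤ 1 + ε`, or it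
dominates, and then the last term of the sum over `j < s` suffices. A coefficient close to `1` is
essential: it must be absorbed by the survival factor `1 - lam`. -/
theorem polyWeight_add_le {q : ℝ} (hq : 0 ≤ q) {ε : ℝ≥0} (hε : 0 < ε) :
    ∃ C : ℝ≥0, ∀ k s : ℕ, polyWeight q (k + s)
      ≤ (1 + ε) * polyWeight q k + C * ∑ j ∈ Finset.range s, polyWeight q j := by
  obtain ⟨δ, hδ, hδε⟩ : ∃ δ : ℝ≥0, 0 < δ ∧ (1 + δ) ^ q ≤ 1 + ε := by
    have hc : Filter.Tendsto (fun δ : ℝ≥0 => (1 + δ) ^ q) (nhds 0) (nhds ((1 + 0) ^ q)) :=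
      (NNReal.continuousAt_rpow_const (Or.inr hq)).tendsto.comp
        (tendsto_const_nhds.add Filter.tendsto_id)
    have h1 : ((1 + 0 : ℝ≥0)) ^ q < 1 + ε := by simpa using hε
    have h2 := hc.eventually_le_const h1
    have h3 : ∀ᶠ δ : ℝ≥0 in nhdsWithin 0 (Set.Ioi 0), (1 + δ) ^ q ≤ 1 + ε :=
      h2.filter_mono nhdsWithin_le_nhds
    obtain ⟨δ, h4, h5⟩ := (h3.and self_mem_nhdsWithin).exists
    exact ⟨δ, h5, h4⟩
  refine ⟨(1 + δ⁻¹) ^ q, fun k s => ?_⟩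
  rcases s with _ | s
  · simp only [add_zero, Finset.range_zero, Finset.sum_empty, mul_zero]
    exact le_mul_of_one_le_left zero_le (by simp)
  have hsum : ((s : ℝ≥0) + 1) ^ q ≤ ∑ j ∈ Finset.range (s + 1), polyWeight q j :=
    Finset.single_le_sum (f := polyWeight q) (fun _ _ => zero_le) (Finset.self_mem_range_succ s)
  rcases le_total ((s : ℝ≥0) + 1) (δ * ((k : ℝ≥0) + 1)) with h | h
  · refine le_trans ?_ le_self_add
    calc polyWeight q (k + (s + 1)) ≤ ((1 + δ) * ((k : ℝ≥0) + 1)) ^ q := by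
          refine NNReal.rpow_le_rpow ?_ hq
          push_cast
          calc (k : ℝ≥0) + (s + 1) + 1 = (k + 1) + (s + 1) := by ring
            _ ≤ (k + 1) + δ * (k + 1) := by gcongr
            _ = _ := by ring
      _ = (1 + δ) ^ q * polyWeight q k := NNReal.mul_rpow
      _ ≤ _ := by gcongr
  · refine le_trans ?_ le_add_self
    calc polyWeight q (k + (s + 1)) ≤ ((1 + δ⁻¹) * ((s : ℝ≥0) + 1)) ^ q := by
          refine NNReal.rpow_le_rpow ?_ hq
          push_cast
          calc (k : ℝ≥0) + (s + 1) + 1 = δ⁻¹ * (δ * (k + 1)) + (s + 1) := by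
                rw [inv_mul_cancel_left₀ hδ.ne']; ring
            _ ≤ δ⁻¹ * (s + 1) + (s + 1) := by gcongr
            _ = _ := by ring
      _ = (1 + δ⁻¹) ^ q * ((s : ℝ≥0) + 1) ^ q := NNReal.mul_rpow
      _ ≤ _ := by gcongr

theorem tsum_inv_polyWeight_lt_top {q : ℝ} (hq : 1 < q) :
    ∑' k, ((polyWeight q k : ℝ≥0∞))⁻¹ < ∞ := by
  have h1 : Summable fun k : ℕ => (polyWeight q k)⁻¹ := by
    have := NNReal.summable_nat_add _ ((NNReal.summable_rpow_inv (p := q)).2 hq) 1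
    refine this.congr fun k => ?_
    rw [polyWeight, Nat.cast_add, Nat.cast_one]
  have h2 : ∀ k, polyWeight q k ≠ 0 := fun k =>
    (zero_lt_one.trans_le (one_le_polyWeight (zero_le_one.trans hq.le) k)).ne'
  have h3 : ∀ k, ((polyWeight q k : ℝ≥0∞))⁻¹ = ((polyWeight q k)⁻¹ : ℝ≥0) := fun k => by
    rw [ENNReal.coe_inv (h2 k)]
  simp only [h3]
  exact lt_top_iff_ne_top.2 (ENNReal.tsum_coe_ne_top_iff_summable.2 h1)

/-! ### Moments of the regeneration time, and Kac's inequality -/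

section Moments

variable {E : Type u} [MeasurableSpace E] {P : Kernel E E} {A : Set E} {ψ : Measure E} {lam : ℝ≥0}
variable [IsMarkovKernel P] [IsProbabilityMeasure ψ]

/-- Polynomial moments of the lifetime of the killed chain are controlled by those of the return
time to `A`. -/
theorem exists_tsum_polyWeight_killed_le {q : ℝ} (hq : 0 ≤ q) {lam : ℝ≥0} (hlam : 0 < lam) :
    ∃ C : ℝ≥0, ∀ (E : Type u) [MeasurableSpace E] (P : Kernel E E) [IsMarkovKernel P]
      (A : Set E) (hA : MeasurableSet A) (ψ : Measure E) [IsProbabilityMeasure ψ]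
      (h : Minorized P A ψ lam) (ξ : ℝ≥0∞), 1 ≤ ξ →
      (∀ y ∈ A, ∑' k, polyWeight q k * (avoid P hA ^ k) y Set.univ ≤ ξ) → ∀ x,
      ∑' k, polyWeight q k * (killed hA h ^ k) x Set.univ
        ≤ C * (ξ ^ 2 + ξ * ∑' k, polyWeight q k * (avoid P hA ^ k) x Set.univ) := by
  -- `ε = lam / 2` makes `(1 - lam) (1 + ε) + lam / 2 ≤ 1`.
  obtain ⟨C, hC⟩ := polyWeight_add_le hq (half_pos hlam)
  refine ⟨(1 + lam / 2) * (2 / lam * (1 + C / lam)) + (1 + C / lam),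
    fun E _ P _ A hA ψ _ h ξ h1ξ hξ x => ?_⟩
  have hl : (lam : ℝ≥0∞) ≠ 0 := by simpa using hlam.ne'
  have hr : ∀ y ∈ A, ∑' k, (avoid P hA ^ k) y Set.univ ≤ ξ := fun y hy => by
    refine le_trans (ENNReal.tsum_le_tsum fun k => ?_) (hξ y hy)
    exact le_mul_of_one_le_left zero_le (by exact_mod_cast one_le_polyWeight hq k)
  -- The shift term of the weights, summed over a lifetime of mean at most `ξ / lam`.
  set c : ℝ≥0∞ := C * (ξ / lam) with hc
  -- Chosen so that the excursion cost `(1 + c) * ξ` equals `(lam / 2) * K`.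
  set K : ℝ≥0∞ := 2 / lam * ((1 + c) * ξ) with hK
  have hw : ∀ N : ℕ, (∀ n ≤ N, ∀ y ∈ A, ∑ k ∈ Finset.range n,
      (polyWeight q k : ℝ≥0∞) * (killed hA h ^ k) y Set.univ ≤ K) →
      ∀ n ≤ N, ∀ s, ∀ y ∈ A, ∑ k ∈ Finset.range n,
        (polyWeight q (k + s) : ℝ≥0∞) * (killed hA h ^ k) y Set.univ
      ≤ (1 + lam / 2) * K + c * ∑ j ∈ Finset.range s, (polyWeight q j : ℝ≥0∞) := by
    intro N H n hn s y hy
    have h2 : ∀ k, (polyWeight q (k + s) : ℝ≥0∞) ≤ (1 + lam / 2) * polyWeight q k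
        + C * ∑ j ∈ Finset.range s, (polyWeight q j : ℝ≥0∞) := fun k => by
      have := ENNReal.coe_le_coe.2 (hC k s)
      rw [ENNReal.coe_add, ENNReal.coe_mul, ENNReal.coe_mul, ENNReal.coe_add,
        ENNReal.ofNNReal_finsetSum, ENNReal.coe_div two_ne_zero] at this
      exact this
    calc _ ≤ ∑ k ∈ Finset.range n, ((1 + lam / 2) * polyWeight q k
            + C * ∑ j ∈ Finset.range s, (polyWeight q j : ℝ≥0∞)) * (killed hA h ^ k) y Set.univ := by
          gcongr with k; exact h2 k
      _ = (1 + lam / 2) * (∑ k ∈ Finset.range n, polyWeight q k * (killed hA h ^ k) y Set.univ)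
          + (C * ∑ j ∈ Finset.range s, (polyWeight q j : ℝ≥0∞)) *
            ∑ k ∈ Finset.range n, (killed hA h ^ k) y Set.univ := by
          generalize (C : ℝ≥0∞) * ∑ j ∈ Finset.range s, (polyWeight q j : ℝ≥0∞) = D
          rw [Finset.mul_sum, Finset.mul_sum, ← Finset.sum_add_distrib]
          refine Finset.sum_congr rfl fun k _ => ?_
          ring
      _ ≤ (1 + lam / 2) * K + (C * ∑ j ∈ Finset.range s, (polyWeight q j : ℝ≥0∞)) * (ξ / lam) := by
          gcongr
          · exact H n hn y hy
          · exact sum_killed_pow_le_div hA h hlam hr n n le_rfl y hy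
      _ = _ := by rw [hc]; ring
  have hbound : ∀ N : ℕ, ∀ n ≤ N, ∀ y ∈ A, ∑ k ∈ Finset.range n,
      (polyWeight q k : ℝ≥0∞) * (killed hA h ^ k) y Set.univ ≤ K := by
    intro N
    induction N with
    | zero => intro n hn y _; simp [Nat.le_zero.1 hn]
    | succ N ih =>
      intro n hn y hy
      have := sum_killed_pow_le_of_mem hA h (fun k => (polyWeight q k : ℝ≥0∞))
        ((1 + lam / 2) * K) c N (hw N ih) hy
      refine (Finset.sum_le_sum_of_subset (Finset.range_mono hn)).trans (this.trans ?_)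
      have hK2 : (1 + c) * ξ = (lam / 2) * K := by
        have : (lam / 2 : ℝ≥0∞) * (2 / lam) = 1 := by
          rw [← ENNReal.coe_ofNat, ← ENNReal.coe_div two_ne_zero, ← ENNReal.coe_div hlam.ne',
            ← ENNReal.coe_mul, div_mul_div_cancel₀ two_ne_zero, div_self hlam.ne']
          rfl
        rw [hK, ← mul_assoc, this, one_mul]
      have hcoef : (1 - lam : ℝ≥0∞) * (1 + lam / 2) + lam / 2 ≤ 1 := by
        have h1 : lam ≤ 1 := h.le_one hy
        have : (1 - lam) * (1 + lam / 2) + lam / 2 ≤ 1 := by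
          rw [← NNReal.coe_le_coe]
          push_cast [NNReal.coe_sub h1]
          nlinarith [lam.2]
        have h3 := ENNReal.coe_le_coe.2 this
        rw [ENNReal.coe_add, ENNReal.coe_mul, ENNReal.coe_add, ENNReal.coe_div two_ne_zero,
          ENNReal.coe_sub] at h3
        exact h3
      calc _ ≤ (1 - lam : ℝ≥0∞) * ((1 + lam / 2) * K) + (1 + c) * ξ := by
            gcongr; exact hξ y hy
        _ = ((1 - lam : ℝ≥0∞) * (1 + lam / 2) + lam / 2) * K := by rw [hK2]; ring
        _ ≤ 1 * K := by gcongr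
        _ = K := one_mul K
  have hfin : ∑' k, (polyWeight q k : ℝ≥0∞) * (killed hA h ^ k) x Set.univ
      ≤ (1 + lam / 2) * K + (1 + c) * ∑' k, polyWeight q k * (avoid P hA ^ k) x Set.univ := by
    refine ENNReal.tsum_le_of_sum_range_le fun N => ?_
    simpa using sum_killed_pow_le hA h (fun k => (polyWeight q k : ℝ≥0∞)) ((1 + lam / 2) * K) c N
      (hw N (hbound N)) N le_rfl 0 x
  -- `c` is itself of order `ξ`: this is the origin of the square in `ξ ^ 2`.
  have hc1 : 1 + c ≤ (1 + C / lam) * ξ := by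
    rw [hc, add_mul, one_mul]
    refine add_le_add h1ξ (le_of_eq ?_)
    simp only [ENNReal.div_eq_inv_mul]; ring
  have hcoe : (((1 + lam / 2) * (2 / lam * (1 + C / lam)) + (1 + C / lam) : ℝ≥0) : ℝ≥0∞)
      = (1 + lam / 2) * (2 / lam * (1 + C / lam)) + (1 + C / lam) := by
    simp only [ENNReal.coe_add, ENNReal.coe_mul, ENNReal.coe_div two_ne_zero,
      ENNReal.coe_div hlam.ne']
    rfl
  rw [hcoe]
  refine hfin.trans ?_
  set m := ∑' k, (polyWeight q k : ℝ≥0∞) * (avoid P hA ^ k) x Set.univ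
  calc _ ≤ (1 + lam / 2) * (2 / lam * (((1 + C / lam) * ξ) * ξ)) + ((1 + C / lam) * ξ) * m := by
        rw [hK]; gcongr
    _ = (1 + lam / 2) * (2 / lam * (1 + C / lam)) * ξ ^ 2 + (1 + C / lam) * (ξ * m) := by ring
    _ ≤ _ := by
        rw [mul_add _ (ξ ^ 2)]
        exact add_le_add (mul_le_mul' le_self_add le_rfl) (mul_le_mul' le_add_self le_rfl)

/-- Inequality form of Kac's formula. -/
theorem one_le_mul_of_tsum_avoid_le (hA : MeasurableSet A) {π : Measure E} [IsProbabilityMeasure π]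
    (hπ : Kernel.Invariant P π) {ξ : ℝ≥0∞}
    (hξ : ∀ y ∈ A, ∑' k, (avoid P hA ^ k) y Set.univ ≤ ξ)
    (hlim : ∀ x, Filter.Tendsto (fun k => (avoid P hA ^ k) x Set.univ) Filter.atTop (nhds 0)) :
    1 ≤ π A * ξ := by
  have hstep : ∀ N : ℕ, ∫⁻ x, (avoid P hA ^ (N + 1)) x Set.univ ∂π
      = ∫⁻ x in Aᶜ, (avoid P hA ^ N) x Set.univ ∂π := by
    intro N
    simp only [avoid_pow_succ]
    have hm : Measurable (Aᶜ.indicator fun x => (avoid P hA ^ N) x Set.univ) :=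
      (measurable_pow_univ _ N).indicator hA.compl
    conv_rhs => rw [← hπ.def]
    rw [← lintegral_indicator hA.compl, Measure.lintegral_bind P.aemeasurable hm.aemeasurable]
    simp only [lintegral_indicator hA.compl]
  -- By stationarity the `k`-th summand is the probability that the last visit to `A` among the
  -- times `1, …, N` occurs at time `N - k`; the final term is the probability of no visit.
  have hid : ∀ N : ℕ, ∑ k ∈ Finset.range N, ∫⁻ x in A, (avoid P hA ^ k) x Set.univ ∂π
      + ∫⁻ x, (avoid P hA ^ N) x Set.univ ∂π = 1 := by
    intro N
    induction N with
    | zero => simp only [avoid_pow_zero]; simp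
    | succ N ih => rw [Finset.sum_range_succ, hstep, add_assoc, lintegral_add_compl _ hA, ih]
  have hle1 : ∀ k x, (avoid P hA ^ k) x Set.univ ≤ 1 := by
    intro k
    induction k with
    | zero => intro x; rw [avoid_pow_zero]
    | succ k ih =>
      intro x
      rw [avoid_pow_succ]
      calc _ ≤ ∫⁻ y in Aᶜ, 1 ∂(P x) := lintegral_mono fun y => ih y
        _ ≤ 1 := by rw [setLIntegral_one]; exact prob_le_one
  have hle : ∀ N : ℕ, 1 ≤ π A * ξ + ∫⁻ x, (avoid P hA ^ N) x Set.univ ∂π := by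
    intro N
    rw [← hid N]
    gcongr
    rw [← lintegral_finsetSum _ fun k _ => measurable_pow_univ _ k]
    calc _ ≤ ∫⁻ x in A, ξ ∂π :=
          setLIntegral_mono measurable_const fun x hx => (ENNReal.sum_le_tsum _).trans (hξ x hx)
      _ = π A * ξ := by rw [setLIntegral_const, mul_comm]
  have hz : Filter.Tendsto (fun N => ∫⁻ x, (avoid P hA ^ N) x Set.univ ∂π) Filter.atTop
      (nhds 0) := by
    have := tendsto_lintegral_of_dominated_convergence (μ := π) (fun _ => 1)
      (fun k => measurable_pow_univ (avoid P hA) k) (fun k => .of_forall fun x => hle1 k x)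
      (by simp) (.of_forall hlim)
    simpa using this
  simpa using ge_of_tendsto' (tendsto_const_nhds.add hz) hle

end Moments

/-- One of `v ≤ α u` and `u ≤ α⁻¹ v` holds, and one term then suffices; infinite values of `u` and
`v` need no separate treatment. -/
theorem ennreal_mul_le_young (u v α : ℝ≥0∞) (h0 : α ≠ 0) (ht : α ≠ ∞) :
    u * v ≤ α * u ^ 2 + α⁻¹ * v ^ 2 := by
  rcases le_total v (α * u) with h | h
  · refine le_trans ?_ le_self_add
    calc u * v ≤ u * (α * u) := by gcongr
      _ = α * u ^ 2 := by ring
  · refine le_trans ?_ le_add_self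
    have : u ≤ α⁻¹ * v := by
      calc u = α⁻¹ * (α * u) := by rw [← mul_assoc, ENNReal.inv_mul_cancel h0 ht, one_mul]
        _ ≤ _ := by gcongr
    calc u * v ≤ (α⁻¹ * v) * v := by gcongr
      _ = _ := by ring

/-! ### Weighted Young inequalities for series of kernel powers -/

section Covariance

variable {E : Type u} [MeasurableSpace E] {κ : Kernel E E} {π : Measure E}

/-- Sums of `∫ G · κ ^ k G` for powers of a sub-Markovian kernel `κ` with excessive measure `π`. -/
theorem tsum_lintegral_mul_pow_le (hπ : π.bind κ ≤ π) {G : E → ℝ≥0∞} (hG : Measurable G)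
    (a : ℕ → ℝ≥0) (ha : ∀ k, a k ≠ 0) :
    ∑' k, ∫⁻ x, G x * ∫⁻ y, G y ∂((κ ^ k) x) ∂π
      ≤ ∫⁻ x, G x ^ 2 * ∑' k, a k * (κ ^ k) x Set.univ ∂π
        + (∑' k, (a k : ℝ≥0∞)⁻¹) * ∫⁻ x, G x ^ 2 ∂π := by
  have hpow : ∀ k : ℕ, ∀ f : E → ℝ≥0∞, Measurable f →
      ∫⁻ x, ∫⁻ y, f y ∂((κ ^ k) x) ∂π ≤ ∫⁻ x, f x ∂π := by
    intro k
    induction k with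
    | zero => intro f hf; simp only [lintegral_pow_zero hf]; rfl
    | succ k ih =>
      intro f hf
      simp only [lintegral_pow_succ' hf]
      refine (ih _ hf.lintegral_kernel).trans ?_
      rw [← Measure.lintegral_bind κ.aemeasurable hf.aemeasurable]
      exact lintegral_mono' hπ le_rfl
  have hG2 : Measurable fun x => G x ^ 2 := hG.pow_const 2
  have hm : ∀ k, Measurable fun x => G x ^ 2 * (a k * (κ ^ k) x Set.univ) := fun k =>
    hG2.mul ((measurable_pow_univ κ k).const_mul _)
  -- Young's inequality with weight `a k`: the square at `x` retains the survival probability, while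
  -- the square at `y` integrates to at most `∫ G²` because `π` is excessive.
  have hterm : ∀ k, ∫⁻ x, G x * ∫⁻ y, G y ∂((κ ^ k) x) ∂π
      ≤ ∫⁻ x, G x ^ 2 * (a k * (κ ^ k) x Set.univ) ∂π + (a k : ℝ≥0∞)⁻¹ * ∫⁻ x, G x ^ 2 ∂π := by
    intro k
    calc ∫⁻ x, G x * ∫⁻ y, G y ∂((κ ^ k) x) ∂π
        ≤ ∫⁻ x, (G x ^ 2 * (a k * (κ ^ k) x Set.univ)
            + (a k : ℝ≥0∞)⁻¹ * ∫⁻ y, G y ^ 2 ∂((κ ^ k) x)) ∂π := by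
          refine lintegral_mono fun x => ?_
          rw [← lintegral_const_mul _ hG, ← lintegral_const_mul _ hG2]
          calc ∫⁻ y, G x * G y ∂((κ ^ k) x)
              ≤ ∫⁻ y, (a k * G x ^ 2 + (a k : ℝ≥0∞)⁻¹ * G y ^ 2) ∂((κ ^ k) x) :=
                lintegral_mono fun y => ennreal_mul_le_young _ _ _
                  (by simpa using ha k) ENNReal.coe_ne_top
            _ = _ := by
                rw [lintegral_add_left measurable_const, lintegral_const]
                congr 1; ring
      _ = ∫⁻ x, G x ^ 2 * (a k * (κ ^ k) x Set.univ) ∂π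
            + (a k : ℝ≥0∞)⁻¹ * ∫⁻ x, ∫⁻ y, G y ^ 2 ∂((κ ^ k) x) ∂π := by
          rw [lintegral_add_left (hm k),
            lintegral_const_mul _ hG2.lintegral_kernel]
      _ ≤ _ := by exact add_le_add_right (mul_le_mul_right (hpow k _ hG2) _) _
  refine (ENNReal.tsum_le_tsum hterm).trans ?_
  rw [ENNReal.tsum_add, ENNReal.tsum_mul_right, ← lintegral_tsum fun k =>
    (hm k).aemeasurable]
  simp only [ENNReal.tsum_mul_left]
  rfl

/-- The same splitting with `y` drawn from `π` independently of the chain, so that no relation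
between `π` and `κ` is needed. -/
theorem tsum_lintegral_pow_mul_le [IsProbabilityMeasure π] (hκ : ∀ k x, (κ ^ k) x Set.univ ≤ 1)
    {G : E → ℝ≥0∞} (hG : Measurable G) (a : ℕ → ℝ≥0) (ha : ∀ k, a k ≠ 0) :
    (∑' k, ∫⁻ x, G x * (κ ^ k) x Set.univ ∂π) * ∫⁻ x, G x ∂π
      ≤ ∫⁻ x, G x ^ 2 * ∑' k, a k * (κ ^ k) x Set.univ ∂π
        + (∑' k, (a k : ℝ≥0∞)⁻¹) * ∫⁻ x, G x ^ 2 ∂π := by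
  have hG2 : Measurable fun x => G x ^ 2 := hG.pow_const 2
  have hm : ∀ k, Measurable fun x => G x ^ 2 * (a k * (κ ^ k) x Set.univ) := fun k =>
    hG2.mul ((measurable_pow_univ κ k).const_mul _)
  have hterm : ∀ k, (∫⁻ x, G x * (κ ^ k) x Set.univ ∂π) * ∫⁻ x, G x ∂π
      ≤ ∫⁻ x, G x ^ 2 * (a k * (κ ^ k) x Set.univ) ∂π + (a k : ℝ≥0∞)⁻¹ * ∫⁻ x, G x ^ 2 ∂π := by
    intro k
    have hGq : Measurable fun x => G x * (κ ^ k) x Set.univ := hG.mul (measurable_pow_univ κ k)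
    rw [← lintegral_mul_const _ hGq]
    calc ∫⁻ x, G x * (κ ^ k) x Set.univ * ∫⁻ y, G y ∂π ∂π
        ≤ ∫⁻ x, (G x ^ 2 * (a k * (κ ^ k) x Set.univ)
            + (a k : ℝ≥0∞)⁻¹ * ∫⁻ y, G y ^ 2 ∂π) ∂π := by
          refine lintegral_mono fun x => ?_
          rw [← lintegral_const_mul _ hG, ← lintegral_const_mul _ hG2]
          calc ∫⁻ y, G x * (κ ^ k) x Set.univ * G y ∂π
              ≤ ∫⁻ y, (G x ^ 2 * (a k * (κ ^ k) x Set.univ) + (a k : ℝ≥0∞)⁻¹ * G y ^ 2) ∂π := by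
                refine lintegral_mono fun y => ?_
                calc _ = (G x * G y) * (κ ^ k) x Set.univ := by ring
                  _ ≤ (a k * G x ^ 2 + (a k : ℝ≥0∞)⁻¹ * G y ^ 2) * (κ ^ k) x Set.univ := by
                    gcongr
                    exact ennreal_mul_le_young _ _ _ (by simpa using ha k) ENNReal.coe_ne_top
                  _ = G x ^ 2 * (a k * (κ ^ k) x Set.univ)
                      + (a k : ℝ≥0∞)⁻¹ * G y ^ 2 * (κ ^ k) x Set.univ := by ring
                  _ ≤ G x ^ 2 * (a k * (κ ^ k) x Set.univ)
                      + (a k : ℝ≥0∞)⁻¹ * G y ^ 2 * 1 := by gcongr; exact hκ k x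
                  _ = _ := by rw [mul_one]
            _ = _ := by
                rw [lintegral_add_left measurable_const, lintegral_const, measure_univ (μ := π), mul_one]
      _ = _ := by
          rw [lintegral_add_left (hm k),
            lintegral_const, measure_univ, mul_one]
  rw [← ENNReal.tsum_mul_right]
  refine (ENNReal.tsum_le_tsum hterm).trans ?_
  rw [ENNReal.tsum_add, ENNReal.tsum_mul_right, ← lintegral_tsum fun k =>
    (hm k).aemeasurable]
  simp only [ENNReal.tsum_mul_left]
  rfl

theorem sq_lintegral_le [IsProbabilityMeasure π] {G : E → ℝ≥0∞} (hG : Measurable G) :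
    (∫⁻ x, G x ∂π) ^ 2 ≤ 2 * ∫⁻ x, G x ^ 2 ∂π := by
  have hG2 : Measurable fun x => G x ^ 2 := hG.pow_const 2
  rw [sq, ← lintegral_mul_const _ hG]
  calc _ ≤ ∫⁻ x, (G x ^ 2 + ∫⁻ y, G y ^ 2 ∂π) ∂π := by
        refine lintegral_mono fun x => ?_
        rw [← lintegral_const_mul _ hG]
        calc _ ≤ ∫⁻ y, (G x ^ 2 + G y ^ 2) ∂π := by
              refine lintegral_mono fun y => ?_
              simpa using ennreal_mul_le_young (G x) (G y) 1 one_ne_zero ENNReal.one_ne_top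
          _ = _ := by
              rw [lintegral_add_left measurable_const, lintegral_const, measure_univ, mul_one]
    _ = _ := by
        rw [lintegral_add_left hG2, lintegral_const, measure_univ, mul_one, two_mul]

end Covariance

/-! ### First-regeneration decomposition for bounded functions -/

section Bounded

variable {E : Type u} [MeasurableSpace E] {P : Kernel E E} {A : Set E} {ψ : Measure E} {lam : ℝ≥0}
  {g : E → ℝ} {B : ℝ}

theorem integrable_of_abs_le (hg : Measurable g) (hB : ∀ x, |g x| ≤ B) (μ : Measure E)
    [IsFiniteMeasure μ] : Integrable g μ :=
  Integrable.of_bound hg.aestronglyMeasurable B (.of_forall hB)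

theorem measurable_integral_kernel {κ : Kernel E E} [IsFiniteKernel κ] (hg : Measurable g) :
    Measurable fun x => ∫ y, g y ∂(κ x) :=
  (hg.stronglyMeasurable.integral_kernel).measurable

theorem integral_pow_succ {κ : Kernel E E} [IsFiniteKernel κ] (hg : Measurable g)
    (hB : ∀ x, |g x| ≤ B) (k : ℕ) [IsFiniteKernel (κ ^ k)] (x : E) :
    ∫ y, g y ∂((κ ^ (k + 1)) x) = ∫ z, ∫ y, g y ∂((κ ^ k) z) ∂(κ x) := by
  have : IsFiniteMeasure (((κ ^ k) ∘ₖ κ) x) := inferInstance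
  rw [pow_succ]
  exact Kernel.integral_comp (integrable_of_abs_le hg hB (((κ ^ k) ∘ₖ κ) x))

theorem integral_pow_zero {κ : Kernel E E} (hg : Measurable g) (x : E) :
    ∫ y, g y ∂((κ ^ 0) x) = g x := by
  rw [pow_zero]
  change ∫ y, g y ∂((Kernel.id : Kernel E E) x) = g x
  rw [Kernel.id_apply, integral_dirac' _ _ hg.stronglyMeasurable]

theorem abs_integral_le {μ : Measure E} (hμ : μ Set.univ ≤ 1) (h0 : 0 ≤ B)
    (hB : ∀ x, |g x| ≤ B) : |∫ y, g y ∂μ| ≤ B := by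
  have : IsFiniteMeasure μ := ⟨hμ.trans_lt ENNReal.one_lt_top⟩
  refine (norm_integral_le_of_norm_le_const (μ := μ) (f := g) (C := B) (.of_forall hB)).trans ?_
  exact mul_le_of_le_one_right h0 (ENNReal.toReal_le_of_le_ofReal zero_le_one (by simpa using hμ))

variable [IsMarkovKernel P] [IsProbabilityMeasure ψ]
variable (hA : MeasurableSet A) (h : Minorized P A ψ lam)

instance : IsFiniteKernel (killed hA h) :=
  ⟨⟨1, ENNReal.one_lt_top, killed_univ_le hA h⟩⟩

instance (k : ℕ) : IsFiniteKernel (killed hA h ^ k) :=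
  ⟨⟨1, ENNReal.one_lt_top, killed_pow_univ_le hA h k⟩⟩

/-- The mass lost by `killed` at `x` is the regeneration probability, `lam` on `A` and `0`
elsewhere; written this way, one formula covers both cases. -/
theorem integral_eq_killed_add {f : E → ℝ} {D : ℝ} (hf : Measurable f) (hD : ∀ x, |f x| ≤ D)
    (x : E) : ∫ y, f y ∂(P x)
      = ∫ y, f y ∂(killed hA h x) + (1 - (killed hA h x).real Set.univ) * ∫ y, f y ∂ψ := by
  by_cases hx : x ∈ A
  · have h1 : (killed hA h x).real Set.univ = 1 - lam := by
      rw [Measure.real, killed_univ hA h hx, ENNReal.toReal_sub_of_le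
        (by exact_mod_cast h.le_one hx) ENNReal.one_ne_top]
      simp
    rw [h1, ← killed_add hA h hx, integral_add_measure (integrable_of_abs_le hf hD _)
      (integrable_of_abs_le hf hD _), integral_smul_nnreal_measure, NNReal.smul_def, smul_eq_mul]
    simp
  · rw [killed_of_notMem hA h hx]
    simp

/-- Decomposition of the powers of `P` along the first regeneration. -/
theorem sum_integral_pow (hg : Measurable g) (hB : ∀ x, |g x| ≤ B) (m : ℕ) (x : E) :
    ∑ k ∈ Finset.range m, ∫ y, g y ∂((P ^ k) x)
      = ∑ k ∈ Finset.range m, ∫ y, g y ∂((killed hA h ^ k) x)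
        + ∑ j ∈ Finset.range m, (∫ z, ∫ y, g y ∂((P ^ j) z) ∂ψ)
          * (1 - ((killed hA h ^ (m - 1 - j)) x).real Set.univ) := by
  have h0 : 0 ≤ B := (abs_nonneg _).trans (hB x)
  have hreal0 : ∀ x, ((killed hA h ^ 0) x).real Set.univ = 1 := fun x => by
    rw [Measure.real, killed_pow_zero, ENNReal.toReal_one]
  have hrealS : ∀ k x, ((killed hA h ^ (k + 1)) x).real Set.univ
      = ∫ z, ((killed hA h ^ k) z).real Set.univ ∂(killed hA h x) := fun k x => by
    have := integral_pow_succ (κ := killed hA h) (g := fun _ => 1) (B := 1) measurable_const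
      (by simp) k x
    simpa using this
  have hreal1 : ∀ x, ((killed hA h ^ 1) x).real Set.univ = (killed hA h x).real Set.univ :=
    fun x => by rw [pow_one]
  have hqm : ∀ k, Measurable fun z => ((killed hA h ^ k) z).real Set.univ := fun k =>
    (measurable_pow_univ _ k).ennreal_toReal
  have hqb : ∀ k z, |((killed hA h ^ k) z).real Set.univ| ≤ 1 := fun k z => by
    rw [abs_of_nonneg measureReal_nonneg]
    exact ENNReal.toReal_le_of_le_ofReal zero_le_one (by simpa using killed_pow_univ_le hA h k z)
  have hPm : ∀ k, Measurable fun z => ∫ y, g y ∂((P ^ k) z) := fun k =>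
    measurable_integral_kernel hg
  have hPb : ∀ k z, |∫ y, g y ∂((P ^ k) z)| ≤ B := fun k z => abs_integral_le prob_le_one h0 hB
  have hQm : ∀ k, Measurable fun z => ∫ y, g y ∂((killed hA h ^ k) z) := fun k =>
    measurable_integral_kernel hg
  have hQb : ∀ k z, |∫ y, g y ∂((killed hA h ^ k) z)| ≤ B := fun k z =>
    abs_integral_le (killed_pow_univ_le hA h k z) h0 hB
  set b : ℕ → ℝ := fun j => ∫ z, ∫ y, g y ∂((P ^ j) z) ∂ψ with hb
  induction m generalizing x with
  | zero => simp
  | succ m ih =>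
    -- The first step either regenerates, after which the chain starts from `ψ` and contributes the
    -- `b j`, or survives, and the induction hypothesis applies (`e2`).
    have e1 : ∑ k ∈ Finset.range m, ∫ y, g y ∂((P ^ (k + 1)) x)
        = ∫ z, ∑ k ∈ Finset.range m, ∫ y, g y ∂((P ^ k) z) ∂(killed hA h x)
          + (1 - (killed hA h x).real Set.univ) * ∑ j ∈ Finset.range m, b j := by
      rw [integral_finsetSum _ fun k _ => integrable_of_abs_le (hPm k) (hPb k) _, Finset.mul_sum,
        ← Finset.sum_add_distrib]
      refine Finset.sum_congr rfl fun k _ => ?_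
      rw [integral_pow_succ hg hB, integral_eq_killed_add hA h (hPm k) (hPb k)]
    have e2 : ∫ z, ∑ k ∈ Finset.range m, ∫ y, g y ∂((P ^ k) z) ∂(killed hA h x)
        = ∑ k ∈ Finset.range m, ∫ y, g y ∂((killed hA h ^ (k + 1)) x)
          + ∑ j ∈ Finset.range m, b j * ((killed hA h x).real Set.univ
            - ((killed hA h ^ (m - j)) x).real Set.univ) := by
      simp only [ih]
      have hint : ∀ j, Integrable (fun z => b j *
          (1 - ((killed hA h ^ (m - 1 - j)) z).real Set.univ)) (killed hA h x) := fun j =>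
        ((integrable_const 1).sub (integrable_of_abs_le (hqm _) (hqb _) _)).const_mul _
      rw [integral_add (integrable_finsetSum _ fun k _ => integrable_of_abs_le (hQm k) (hQb k) _)
        (integrable_finsetSum _ fun j _ => hint j),
        integral_finsetSum _ fun k _ => integrable_of_abs_le (hQm k) (hQb k) _,
        integral_finsetSum _ fun j _ => hint j]
      congr 1
      · exact Finset.sum_congr rfl fun k _ => (integral_pow_succ hg hB k x).symm
      · refine Finset.sum_congr rfl fun j hj => ?_
        rw [integral_const_mul, integral_sub (integrable_const 1)
          (integrable_of_abs_le (hqm _) (hqb _) _), ← hrealS, integral_const]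
        have : m - 1 - j + 1 = m - j := by have := Finset.mem_range.1 hj; omega
        rw [this]; simp
    rw [Finset.sum_range_succ', Finset.sum_range_succ' (fun k => ∫ y, g y ∂((killed hA h ^ k) x)),
      e1, e2, Finset.sum_range_succ (n := m), integral_pow_zero hg, integral_pow_zero hg]
    -- The new term `j = m` has coefficient `1 - 1 = 0`, as a regeneration takes at least one step.
    have e3 : m + 1 - 1 - m = 0 := by omega
    rw [e3, hreal0, sub_self, mul_zero, add_zero]
    have e4 : ∑ j ∈ Finset.range m, b j * ((killed hA h x).real Set.univ
            - ((killed hA h ^ (m - j)) x).real Set.univ)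
          + (1 - (killed hA h x).real Set.univ) * ∑ j ∈ Finset.range m, b j
        = ∑ j ∈ Finset.range m, b j * (1 - ((killed hA h ^ (m + 1 - 1 - j)) x).real Set.univ) := by
      rw [Finset.mul_sum, ← Finset.sum_add_distrib]
      refine Finset.sum_congr rfl fun j _ => ?_
      rw [Nat.add_sub_cancel]; ring
    linarith

end Bounded

/-! ### Covariances and second moments in the stationary regime -/

section Variance

variable {E : Type u} [MeasurableSpace E] {P : Kernel E E} {A : Set E} {ψ : Measure E} {lam : ℝ≥0}
  {g : E → ℝ} {B : ℝ} {π : Measure E}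

theorem lintegral_invariant_pow (hπ : Kernel.Invariant P π) {f : E → ℝ≥0∞} (hf : Measurable f)
    (k : ℕ) : ∫⁻ x, ∫⁻ y, f y ∂((P ^ k) x) ∂π = ∫⁻ x, f x ∂π := by
  induction k generalizing f with
  | zero => simp only [lintegral_pow_zero hf]
  | succ k ih =>
    simp only [lintegral_pow_succ' hf]
    rw [ih hf.lintegral_kernel, ← Measure.lintegral_bind P.aemeasurable hf.aemeasurable, hπ.def]

/-- `π = πP` dominates the contribution of the steps leaving `A`, hence `lam π(A) ψ`. -/
theorem lintegral_minorant_le (hπ : Kernel.Invariant P π)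
    (h : Minorized P A ψ lam) {f : E → ℝ≥0∞} (hf : Measurable f) :
    lam * π A * ∫⁻ x, f x ∂ψ ≤ ∫⁻ x, f x ∂π := by
  calc lam * π A * ∫⁻ x, f x ∂ψ = ∫⁻ _ in A, lam * ∫⁻ x, f x ∂ψ ∂π := by
        rw [setLIntegral_const]; ring
    _ ≤ ∫⁻ x in A, ∫⁻ y, f y ∂(P x) ∂π := by
        refine setLIntegral_mono hf.lintegral_kernel fun x hx => ?_
        calc lam * ∫⁻ x, f x ∂ψ = ∫⁻ x, f x ∂(lam • ψ) := by
              rw [lintegral_smul_measure, ENNReal.smul_def, smul_eq_mul]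
          _ ≤ _ := lintegral_mono' (h.smul_le hx) le_rfl
    _ ≤ ∫⁻ x, ∫⁻ y, f y ∂(P x) ∂π := setLIntegral_le_lintegral _ _
    _ = _ := by rw [← Measure.lintegral_bind P.aemeasurable hf.aemeasurable, hπ.def]

/-- With Kac's inequality, `ψ ≤ (ξ / lam) π`; and `π` is invariant under `P ^ k`. -/
theorem lintegral_minorant_pow_le (hπ : Kernel.Invariant P π)
    (h : Minorized P A ψ lam) (hlam : 0 < lam) {ξ : ℝ≥0∞} (hξ : 1 ≤ π A * ξ) {f : E → ℝ≥0∞}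
    (hf : Measurable f) (k : ℕ) :
    ∫⁻ z, ∫⁻ y, f y ∂((P ^ k) z) ∂ψ ≤ ξ / lam * ∫⁻ x, f x ∂π := by
  have hl : (lam : ℝ≥0∞) ≠ 0 := by simpa using hlam.ne'
  have h1 := lintegral_minorant_le hπ h (hf.lintegral_kernel (κ := P ^ k))
  rw [lintegral_invariant_pow hπ hf] at h1
  calc ∫⁻ z, ∫⁻ y, f y ∂((P ^ k) z) ∂ψ
      ≤ (π A * ξ) * ∫⁻ z, ∫⁻ y, f y ∂((P ^ k) z) ∂ψ := le_mul_of_one_le_left zero_le hξ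
    _ = ξ / lam * (lam * π A * ∫⁻ z, ∫⁻ y, f y ∂((P ^ k) z) ∂ψ) := by
        rw [← mul_assoc, ← mul_assoc, ENNReal.div_mul_cancel hl ENNReal.coe_ne_top]
        ring
    _ ≤ _ := by gcongr

variable [IsMarkovKernel P] [IsProbabilityMeasure π] [IsProbabilityMeasure ψ]

/-- Bound for the covariance of `g (X_0)` and `∑ k < m, g (X_k)` under the stationary law. -/
theorem enorm_integral_mul_sum_le (hπ : Kernel.Invariant P π) (hA : MeasurableSet A)
    (h : Minorized P A ψ lam) (hlam : 0 < lam) {ξ : ℝ≥0∞} (hξ : 1 ≤ π A * ξ)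
    (hg : Measurable g) (hB : ∀ x, |g x| ≤ B) (m : ℕ) :
    ‖∑ k ∈ Finset.range m, ∫ x, g x * ∫ y, g y ∂((P ^ k) x) ∂π‖ₑ
      ≤ ∑' k, ∫⁻ x, ‖g x‖ₑ * ∫⁻ y, ‖g y‖ₑ ∂((killed hA h ^ k) x) ∂π
        + (ξ / lam * ∫⁻ x, ‖g x‖ₑ ∂π) * (m * ‖∫ x, g x ∂π‖ₑ
          + ∑' k, ∫⁻ x, ‖g x‖ₑ * (killed hA h ^ k) x Set.univ ∂π) := by
  obtain ⟨x₀⟩ : Nonempty E := nonempty_of_isProbabilityMeasure π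
  have h0 : 0 ≤ B := (abs_nonneg _).trans (hB x₀)
  have hge : Measurable fun x => ‖g x‖ₑ := hg.enorm
  have hint : ∀ f : E → ℝ, ∀ D : ℝ, Measurable f → (∀ x, |f x| ≤ D) →
      Integrable (fun x => g x * f x) π := fun f D hf hD =>
    integrable_of_abs_le (g := fun x => g x * f x) (B := B * D) (hg.mul hf) (fun x => by
      rw [abs_mul]; exact mul_le_mul (hB x) (hD x) (abs_nonneg _) h0) π
  have hqm : ∀ k, Measurable fun z => ((killed hA h ^ k) z).real Set.univ := fun k =>
    (measurable_pow_univ _ k).ennreal_toReal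
  have hqb : ∀ k z, |((killed hA h ^ k) z).real Set.univ| ≤ 1 := fun k z => by
    rw [abs_of_nonneg measureReal_nonneg]
    exact ENNReal.toReal_le_of_le_ofReal zero_le_one (by simpa using killed_pow_univ_le hA h k z)
  set b : ℕ → ℝ := fun j => ∫ z, ∫ y, g y ∂((P ^ j) z) ∂ψ with hb
  have hbb : ∀ j, ‖b j‖ₑ ≤ ξ / lam * ∫⁻ x, ‖g x‖ₑ ∂π := fun j => by
    calc ‖b j‖ₑ ≤ ∫⁻ z, ‖∫ y, g y ∂((P ^ j) z)‖ₑ ∂ψ := enorm_integral_le_lintegral_enorm _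
      _ ≤ ∫⁻ z, ∫⁻ y, ‖g y‖ₑ ∂((P ^ j) z) ∂ψ :=
          lintegral_mono fun z => enorm_integral_le_lintegral_enorm _
      _ ≤ _ := lintegral_minorant_pow_le hπ h hlam hξ hge j
  -- The term `∫ g dπ` is kept because this will be applied to truncations, which are not centered.
  have e1 : ∑ k ∈ Finset.range m, ∫ x, g x * ∫ y, g y ∂((P ^ k) x) ∂π
      = ∑ k ∈ Finset.range m, ∫ x, g x * ∫ y, g y ∂((killed hA h ^ k) x) ∂π
        + ∑ j ∈ Finset.range m, b j * (∫ x, g x ∂π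
          - ∫ x, g x * ((killed hA h ^ (m - 1 - j)) x).real Set.univ ∂π) := by
    have hi1 : ∀ k, Integrable (fun x => g x * ∫ y, g y ∂((P ^ k) x)) π := fun k =>
      hint _ B (measurable_integral_kernel hg) fun z => abs_integral_le prob_le_one h0 hB
    have hi2 : ∀ k, Integrable (fun x => g x * ∫ y, g y ∂((killed hA h ^ k) x)) π := fun k =>
      hint _ B (measurable_integral_kernel hg) fun z =>
        abs_integral_le (killed_pow_univ_le hA h k z) h0 hB
    have hi3 : ∀ k, Integrable (fun x => g x * ((killed hA h ^ k) x).real Set.univ) π := fun k =>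
      hint _ 1 (hqm k) (hqb k)
    have hi4 : Integrable g π := integrable_of_abs_le hg hB π
    have e2 : ∀ j, b j * (∫ x, g x ∂π
          - ∫ x, g x * ((killed hA h ^ (m - 1 - j)) x).real Set.univ ∂π)
        = ∫ x, b j * (g x - g x * ((killed hA h ^ (m - 1 - j)) x).real Set.univ) ∂π := fun j => by
      rw [integral_const_mul, integral_sub hi4 (hi3 _)]
    have hi5 : ∀ j, Integrable (fun x =>
        b j * (g x - g x * ((killed hA h ^ (m - 1 - j)) x).real Set.univ)) π := fun j =>
      (hi4.sub (hi3 _)).const_mul _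
    simp only [e2]
    rw [← integral_finsetSum _ fun k _ => hi1 k, ← integral_finsetSum _ fun k _ => hi2 k,
      ← integral_finsetSum _ fun k _ => hi5 k,
      ← integral_add (integrable_finsetSum _ fun k _ => hi2 k)
        (integrable_finsetSum _ fun k _ => hi5 k)]
    refine integral_congr_ae (.of_forall fun x => ?_)
    simp only
    rw [← Finset.mul_sum, ← Finset.mul_sum, sum_integral_pow hA h hg hB m x, mul_add]
    congr 1
    rw [Finset.mul_sum]
    refine Finset.sum_congr rfl fun j _ => ?_
    ring
  have hq : ∀ k, ‖∫ x, g x * ((killed hA h ^ k) x).real Set.univ ∂π‖ₑ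
      ≤ ∫⁻ x, ‖g x‖ₑ * (killed hA h ^ k) x Set.univ ∂π := fun k => by
    refine (enorm_integral_le_lintegral_enorm _).trans (lintegral_mono fun x => ?_)
    rw [enorm_mul]
    gcongr
    rw [Real.enorm_eq_ofReal measureReal_nonneg, Measure.real]
    exact ENNReal.ofReal_toReal_le
  rw [e1]
  refine (enorm_add_le _ _).trans (add_le_add ?_ ?_)
  · refine (enorm_sum_le _ _).trans (le_trans ?_ (ENNReal.sum_le_tsum (Finset.range m)))
    refine Finset.sum_le_sum fun k _ => ?_
    refine (enorm_integral_le_lintegral_enorm _).trans (lintegral_mono fun x => ?_)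
    rw [enorm_mul]
    gcongr
    exact enorm_integral_le_lintegral_enorm _
  · refine (enorm_sum_le _ _).trans ?_
    calc _ ≤ ∑ j ∈ Finset.range m, (ξ / lam * ∫⁻ x, ‖g x‖ₑ ∂π) * (‖∫ x, g x ∂π‖ₑ
          + ∫⁻ x, ‖g x‖ₑ * (killed hA h ^ (m - 1 - j)) x Set.univ ∂π) := by
          refine Finset.sum_le_sum fun j _ => ?_
          rw [enorm_mul]
          gcongr
          · exact hbb j
          · exact (enorm_sub_le).trans (add_le_add le_rfl (hq _))
      _ = (ξ / lam * ∫⁻ x, ‖g x‖ₑ ∂π) * (m * ‖∫ x, g x ∂π‖ₑ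
          + ∑ k ∈ Finset.range m, ∫⁻ x, ‖g x‖ₑ * (killed hA h ^ k) x Set.univ ∂π) := by
          rw [← Finset.mul_sum, Finset.sum_add_distrib, Finset.sum_const, Finset.card_range,
            nsmul_eq_mul, Finset.sum_range_reflect
              (fun k => ∫⁻ x, ‖g x‖ₑ * (killed hA h ^ k) x Set.univ ∂π)]
      _ ≤ _ := by
          gcongr
          exact ENNReal.sum_le_tsum _

theorem integral_chainLaw_mul (hπ : Kernel.Invariant P π) (hg : Measurable g)
    (hB : ∀ x, |g x| ≤ B) (i k : ℕ) :
    ∫ ω, g (ω i) * g (ω (i + k)) ∂(chainLaw P π) = ∫ x, g x * ∫ y, g y ∂((P ^ k) x) ∂π := by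
  obtain ⟨x₀⟩ : Nonempty E := nonempty_of_isProbabilityMeasure π
  have h0 : 0 ≤ B := (abs_nonneg _).trans (hB x₀)
  have hm : Measurable fun z : E × E => g z.1 * g z.2 := by fun_prop
  have := integral_map (μ := chainLaw P π) (φ := fun ω : ℕ → E => (ω i, ω (i + k)))
    (f := fun z : E × E => g z.1 * g z.2) (by fun_prop) hm.aestronglyMeasurable
  simp only at this
  rw [← this, map_pair_chainLaw hπ, Measure.integral_compProd]
  · simp only [integral_const_mul]
  · exact Integrable.of_bound hm.aestronglyMeasurable (B * B) (.of_forall fun z => by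
      rw [norm_mul]; exact mul_le_mul (hB _) (hB _) (abs_nonneg _) h0)

/-- Second moments of the partial sums of a bounded function of the stationary chain. -/
theorem integral_sum_sq_le (hπ : Kernel.Invariant P π) (hg : Measurable g)
    (hB : ∀ x, |g x| ≤ B) {K : ℝ} (n : ℕ)
    (hK : ∀ m ≤ n, ∑ k ∈ Finset.range m, ∫ x, g x * ∫ y, g y ∂((P ^ k) x) ∂π ≤ K) :
    ∫ ω, (∑ i ∈ Finset.Icc 1 n, g (ω i)) ^ 2 ∂(chainLaw P π) ≤ 2 * n * K := by
  obtain ⟨x₀⟩ : Nonempty E := nonempty_of_isProbabilityMeasure π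
  have h0 : 0 ≤ B := (abs_nonneg _).trans (hB x₀)
  set c : ℕ → ℝ := fun k => ∫ x, g x * ∫ y, g y ∂((P ^ k) x) ∂π with hc
  have hi : ∀ i j, Integrable (fun ω : ℕ → E => g (ω i) * g (ω j)) (chainLaw P π) := fun i j =>
    Integrable.of_bound (by fun_prop) (B * B) (.of_forall fun z => by
      rw [norm_mul]; exact mul_le_mul (hB _) (hB _) (abs_nonneg _) h0)
  induction n with
  | zero => simp
  | succ n ih =>
    have hiS : Integrable (fun ω : ℕ → E => (∑ i ∈ Finset.Icc 1 n, g (ω i)) ^ 2)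
        (chainLaw P π) := by
      simp only [sq, Finset.sum_mul_sum]
      exact integrable_finsetSum _ fun i _ => integrable_finsetSum _ fun j _ => hi i j
    have hiX : Integrable (fun ω : ℕ → E => ∑ i ∈ Finset.Icc 1 n, 2 * (g (ω i) * g (ω (n + 1))))
        (chainLaw P π) := integrable_finsetSum _ fun i _ => (hi i _).const_mul 2
    have e1 : ∀ ω : ℕ → E, (∑ i ∈ Finset.Icc 1 (n + 1), g (ω i)) ^ 2
        = (∑ i ∈ Finset.Icc 1 n, g (ω i)) ^ 2
          + ∑ i ∈ Finset.Icc 1 n, 2 * (g (ω i) * g (ω (n + 1))) + g (ω (n + 1)) * g (ω (n + 1)) := by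
      intro ω
      rw [Finset.sum_Icc_succ_top (by omega), ← Finset.mul_sum, ← Finset.sum_mul]
      ring
    have e2 : ∑ i ∈ Finset.Icc 1 n, ∫ ω, g (ω i) * g (ω (n + 1)) ∂(chainLaw P π)
        = ∑ k ∈ Finset.range n, c (k + 1) := by
      refine Finset.sum_nbij' (fun i => n - i) (fun k => n - k) ?_ ?_ ?_ ?_ ?_
      · intro i hi; simp only [Finset.mem_Icc, Finset.mem_range] at *; omega
      · intro i hi; simp only [Finset.mem_Icc, Finset.mem_range] at *; omega
      · intro i hi; simp only [Finset.mem_Icc] at *; omega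
      · intro i hi; simp only [Finset.mem_range] at *; omega
      · intro i hi
        have e : n + 1 = i + (n - i + 1) := by simp only [Finset.mem_Icc] at hi; omega
        rw [e]
        exact integral_chainLaw_mul hπ hg hB i (n - i + 1)
    have e3 : ∫ ω, g (ω (n + 1)) * g (ω (n + 1)) ∂(chainLaw P π) = c 0 :=
      integral_chainLaw_mul hπ hg hB (n + 1) 0
    -- The increment of the second moment is `c 0 + 2 ∑ k ∈ [1, n], c k`; positivity of `c 0` bounds
    -- it by twice the sum controlled by `hK`.
    have hc0 : 0 ≤ c 0 := by
      rw [← e3]; exact integral_nonneg fun ω => mul_self_nonneg _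
    have hiSX : Integrable (fun ω : ℕ → E => (∑ i ∈ Finset.Icc 1 n, g (ω i)) ^ 2
        + ∑ i ∈ Finset.Icc 1 n, 2 * (g (ω i) * g (ω (n + 1)))) (chainLaw P π) := hiS.add hiX
    simp only [e1]
    rw [integral_add hiSX (hi _ _), integral_add hiS hiX,
      integral_finsetSum _ fun i _ => (hi i _).const_mul 2]
    simp only [integral_const_mul]
    rw [← Finset.mul_sum, e2, e3]
    have h1 := ih fun m hm => hK m (by omega)
    have h2 := hK (n + 1) le_rfl
    rw [Finset.sum_range_succ'] at h2
    push_cast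
    linarith

end Variance

/-! ### From survival probabilities to moments of `τ_A` -/

section ReturnTime

variable {E : Type u} [MeasurableSpace E] {P : Kernel E E} {A : Set E} [IsMarkovKernel P]

theorem lintegral_mul_avoid (hA : MeasurableSet A) (ν : Measure E) [IsProbabilityMeasure ν]
    {f : E → ℝ≥0∞} (hf : Measurable f) (k : ℕ) :
    ∫⁻ x, f x * (avoid P hA ^ k) x Set.univ ∂ν
      = ∫⁻ ω, f (ω 0) * (lateReturn A k).indicator 1 ω ∂(chainLaw P ν) := by
  have := lintegral_avoid_pow (P := P) (ν := ν) hA hf k (h := fun _ => 1) measurable_const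
  simp only [lintegral_const, one_mul] at this
  exact this.symm

theorem avoid_pow_apply (hA : MeasurableSet A) (k : ℕ) (x : E) :
    (avoid P hA ^ k) x Set.univ = chainLawAt P x (lateReturn A k) := by
  have := lintegral_mul_avoid (P := P) hA (Measure.dirac x) (f := fun _ => 1) measurable_const k
  simp only [one_mul] at this
  rw [lintegral_dirac' _ (measurable_pow_univ _ k),
    lintegral_indicator_one (measurableSet_lateReturn hA k)] at this
  exact this

theorem tendsto_avoid_pow (hA : MeasurableSet A) {x : E}
    (hx : ∀ᵐ ω ∂(chainLawAt P x), returnTime A ω < ⊤) :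
    Filter.Tendsto (fun k => (avoid P hA ^ k) x Set.univ) Filter.atTop (nhds 0) := by
  have : IsProbabilityMeasure (chainLawAt P x) :=
    inferInstanceAs (IsProbabilityMeasure (chainLaw P (Measure.dirac x)))
  simp only [avoid_pow_apply]
  have h0 : chainLawAt P x (⋂ k, lateReturn A k) = 0 := by
    refine measure_mono_null (fun ω hω => ?_) hx
    simp only [Set.mem_iInter, mem_lateReturn] at hω
    intro hlt
    obtain ⟨t, ht⟩ := ENat.ne_top_iff_exists.1 (ne_of_lt hlt)
    have := hω t
    rw [← ht] at this
    exact lt_irrefl _ this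
  rw [← h0]
  refine tendsto_measure_iInter_atTop
    (fun k => (measurableSet_lateReturn hA k).nullMeasurableSet) ?_ ⟨0, measure_ne_top _ _⟩
  intro i j hij ω hω
  rw [mem_lateReturn] at *
  exact lt_of_le_of_lt (by exact_mod_cast hij) hω

omit [MeasurableSpace E] in
theorem one_le_returnTime (ω : ℕ → E) : 1 ≤ returnTime A ω :=
  le_hittingAfter (u := fun (i : ℕ) (ω : ℕ → E) => ω i) (s := A) (n := 1) ω

omit [MeasurableSpace E] in
-- There are `τ_A` nonzero terms, each at most `τ_A ^ q`. Summation costs one power, which is why `q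
-- = p - 1`.
theorem tsum_polyWeight_lateReturn_le {q : ℝ} (hq : 0 ≤ q) (ω : ℕ → E) :
    ∑' k, (polyWeight q k : ℝ≥0∞) * (lateReturn A k).indicator 1 ω
      ≤ (returnTime A ω : ℝ≥0∞) ^ (q + 1) := by
  rcases eq_or_ne (returnTime A ω) ⊤ with ht | ht
  · rw [ht, ENat.toENNReal_top, ENNReal.top_rpow_of_pos (by linarith)]
    exact le_top
  obtain ⟨t, ht⟩ := ENat.ne_top_iff_exists.1 ht
  have h1 : 1 ≤ t := by
    have := one_le_returnTime (A := A) ω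
    rw [← ht] at this
    exact_mod_cast this
  have hmem : ∀ k, ω ∈ lateReturn A k ↔ k < t := fun k => by
    rw [mem_lateReturn, ← ht]; exact Nat.cast_lt
  rw [tsum_eq_sum (s := Finset.range t)]
  · calc _ ≤ ∑ k ∈ Finset.range t, (t : ℝ≥0∞) ^ q := by
          refine Finset.sum_le_sum fun k hk => ?_
          have hk' := Finset.mem_range.1 hk
          rw [Set.indicator_of_mem ((hmem k).2 hk'), Pi.one_apply, mul_one, polyWeight,
            ENNReal.coe_rpow_of_nonneg _ hq]
          refine ENNReal.rpow_le_rpow ?_ hq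
          exact_mod_cast hk'
      _ = (t : ℝ≥0∞) ^ (q + 1) := by
          rw [Finset.sum_const, Finset.card_range, nsmul_eq_mul,
            ENNReal.rpow_add_of_nonneg _ _ hq zero_le_one, ENNReal.rpow_one, mul_comm]
      _ = _ := by rw [← ht]; rfl
  · intro k hk
    rw [Set.indicator_of_notMem, mul_zero]
    rw [hmem]; simpa using hk

theorem lintegral_mul_tsum_avoid_le (hA : MeasurableSet A) (ν : Measure E)
    [IsProbabilityMeasure ν] {f : E → ℝ≥0∞} (hf : Measurable f) {q : ℝ} (hq : 0 ≤ q) :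
    ∫⁻ x, f x * ∑' k, polyWeight q k * (avoid P hA ^ k) x Set.univ ∂ν
      ≤ ∫⁻ ω, f (ω 0) * (returnTime A ω : ℝ≥0∞) ^ (q + 1) ∂(chainLaw P ν) := by
  have hm : ∀ k, Measurable fun x => f x * (avoid P hA ^ k) x Set.univ := fun k =>
    hf.mul (measurable_pow_univ _ k)
  have hm2 : ∀ k, Measurable fun ω : ℕ → E =>
      f (ω 0) * (lateReturn A k).indicator (1 : (ℕ → E) → ℝ≥0∞) ω := fun k =>
    (hf.comp (measurable_pi_apply 0)).mul
      (measurable_one.indicator (measurableSet_lateReturn hA k))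
  calc _ = ∫⁻ x, ∑' k, polyWeight q k * (f x * (avoid P hA ^ k) x Set.univ) ∂ν := by
        refine lintegral_congr fun x => ?_
        rw [← ENNReal.tsum_mul_left]
        exact tsum_congr fun k => by ring
    _ = ∑' k, polyWeight q k * ∫⁻ ω, f (ω 0) * (lateReturn A k).indicator 1 ω ∂(chainLaw P ν) := by
        rw [lintegral_tsum fun k => ((hm k).const_mul _).aemeasurable]
        refine tsum_congr fun k => ?_
        rw [lintegral_const_mul _ (hm k), lintegral_mul_avoid hA ν hf]
    _ = ∫⁻ ω, ∑' k, polyWeight q k * (f (ω 0) * (lateReturn A k).indicator 1 ω) ∂(chainLaw P ν) := by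
        rw [lintegral_tsum fun k => ((hm2 k).const_mul _).aemeasurable]
        exact tsum_congr fun k => (lintegral_const_mul _ (hm2 k)).symm
    _ ≤ _ := by
        refine lintegral_mono fun ω => ?_
        calc _ = f (ω 0) * ∑' k, (polyWeight q k : ℝ≥0∞) * (lateReturn A k).indicator 1 ω := by
              rw [← ENNReal.tsum_mul_left]
              exact tsum_congr fun k => by ring
          _ ≤ _ := by gcongr; exact tsum_polyWeight_lateReturn_le hq ω

theorem tsum_avoid_le_returnMoment (hA : MeasurableSet A) {q : ℝ} (hq : 0 ≤ q) {x : E}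
    (hx : x ∈ A) :
    ∑' k, polyWeight q k * (avoid P hA ^ k) x Set.univ ≤ returnMoment P A (q + 1) := by
  have hm : Measurable fun x => ∑' k, (polyWeight q k : ℝ≥0∞) * (avoid P hA ^ k) x Set.univ :=
    Measurable.tsum fun k => (measurable_pow_univ _ k).const_mul _
  have := lintegral_mul_tsum_avoid_le (P := P) hA (Measure.dirac x) (f := fun _ => 1)
    measurable_const hq
  simp only [one_mul] at this
  rw [lintegral_dirac' _ hm] at this
  exact this.trans (le_iSup₂ (f := fun x (_ : x ∈ A) =>
    ∫⁻ ω, (returnTime A ω : ℝ≥0∞) ^ (q + 1) ∂(chainLawAt P x)) x hx)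

theorem one_le_returnMoment {p : ℝ} (hp : 0 < p) {x₀ : E}
    (hx : ∀ᵐ ω ∂(chainLawAt P x₀), returnTime A ω < ⊤) : 1 ≤ returnMoment P A p := by
  have hpr : ∀ x, IsProbabilityMeasure (chainLawAt P x) := fun x =>
    inferInstanceAs (IsProbabilityMeasure (chainLaw P (Measure.dirac x)))
  obtain ⟨ω, hω⟩ := hx.exists
  -- For empty `A` the supremum would be `0`; a finite return time excludes this.
  obtain ⟨x, hxA⟩ : A.Nonempty := by
    rw [Set.nonempty_iff_ne_empty]
    rintro rfl
    rw [returnTime, hittingAfter_empty] at hω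
    exact lt_irrefl _ hω
  refine le_trans ?_ (le_iSup₂ (f := fun x (_ : x ∈ A) =>
    ∫⁻ ω, (returnTime A ω : ℝ≥0∞) ^ p ∂(chainLawAt P x)) x hxA)
  calc (1 : ℝ≥0∞) = ∫⁻ _, 1 ∂(chainLawAt P x) := by simp
    _ ≤ _ := lintegral_mono fun ω => by
      refine ENNReal.one_le_rpow ?_ hp
      exact_mod_cast one_le_returnTime ω

end ReturnTime

/-! ### Truncation and conclusion -/

section Main

variable {E : Type u} [MeasurableSpace E] {P : Kernel E E} {A : Set E} {ψ : Measure E} {lam : ℝ≥0}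
  {g : E → ℝ} {π : Measure E} [IsMarkovKernel P] [IsProbabilityMeasure π] [IsProbabilityMeasure ψ]

theorem lintegral_sum_sq_le_of_bounded (hπ : Kernel.Invariant P π) (hA : MeasurableSet A)
    (h : Minorized P A ψ lam) (hlam : 0 < lam) {ξ : ℝ≥0∞} (hξ : 1 ≤ π A * ξ)
    (hg : Measurable g) {B : ℝ} (hB : ∀ x, |g x| ≤ B) (n : ℕ) :
    ∫⁻ ω, ENNReal.ofReal ((∑ i ∈ Finset.Icc 1 n, g (ω i)) ^ 2) ∂(chainLaw P π)
      ≤ 2 * n * (∑' k, ∫⁻ x, ‖g x‖ₑ * ∫⁻ y, ‖g y‖ₑ ∂((killed hA h ^ k) x) ∂π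
        + (ξ / lam * ∫⁻ x, ‖g x‖ₑ ∂π) * (n * ‖∫ x, g x ∂π‖ₑ
          + ∑' k, ∫⁻ x, ‖g x‖ₑ * (killed hA h ^ k) x Set.univ ∂π)) := by
  rcases Nat.eq_zero_or_pos n with rfl | hn
  · simp
  have key := fun m => enorm_integral_mul_sum_le hπ hA h hlam hξ hg hB m
  set K : ℝ≥0∞ := ∑' k, ∫⁻ x, ‖g x‖ₑ * ∫⁻ y, ‖g y‖ₑ ∂((killed hA h ^ k) x) ∂π
        + (ξ / lam * ∫⁻ x, ‖g x‖ₑ ∂π) * (n * ‖∫ x, g x ∂π‖ₑ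
          + ∑' k, ∫⁻ x, ‖g x‖ₑ * (killed hA h ^ k) x Set.univ ∂π) with hK
  have hn' : (2 * n : ℝ≥0∞) ≠ 0 := by simp [hn.ne']
  rcases eq_or_ne K ∞ with hKt | hKt
  · rw [hKt, ENNReal.mul_top hn']; exact le_top
  obtain ⟨x₀⟩ : Nonempty E := nonempty_of_isProbabilityMeasure π
  have h0 : 0 ≤ B := (abs_nonneg _).trans (hB x₀)
  have hle : ∀ m ≤ n, ∑ k ∈ Finset.range m, ∫ x, g x * ∫ y, g y ∂((P ^ k) x) ∂π ≤ K.toReal := by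
    intro m hm
    refine (le_abs_self _).trans ?_
    rw [← Real.norm_eq_abs, ← toReal_enorm]
    refine ENNReal.toReal_mono hKt ((key m).trans ?_)
    rw [hK]
    gcongr
  have hint : Integrable (fun ω : ℕ → E => (∑ i ∈ Finset.Icc 1 n, g (ω i)) ^ 2) (chainLaw P π) := by
    simp only [sq, Finset.sum_mul_sum]
    exact integrable_finsetSum _ fun i _ => integrable_finsetSum _ fun j _ =>
      Integrable.of_bound (by fun_prop) (B * B) (.of_forall fun z => by
        rw [norm_mul]; exact mul_le_mul (hB _) (hB _) (abs_nonneg _) h0)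
  rw [← ofReal_integral_eq_lintegral_ofReal hint (.of_forall fun ω => sq_nonneg _)]
  refine (ENNReal.ofReal_le_ofReal (integral_sum_sq_le hπ hg hB n hle)).trans (le_of_eq ?_)
  rw [ENNReal.ofReal_mul (by positivity), ENNReal.ofReal_toReal hKt,
    ENNReal.ofReal_mul zero_le_two, ENNReal.ofReal_natCast, ENNReal.ofReal_ofNat]

/-- Second moments of the partial sums of a centered function of the stationary chain. -/
theorem lintegral_sum_sq_le (hπ : Kernel.Invariant P π) (hA : MeasurableSet A)
    (h : Minorized P A ψ lam) (hlam : 0 < lam) {ξ : ℝ≥0∞} (hξ : 1 ≤ π A * ξ) (hξt : ξ ≠ ∞)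
    (hg : Measurable g) (hgi : Integrable g π) (hg0 : ∫ x, g x ∂π = 0) (n : ℕ) :
    ∫⁻ ω, ENNReal.ofReal ((∑ i ∈ Finset.Icc 1 n, g (ω i)) ^ 2) ∂(chainLaw P π)
      ≤ 2 * n * (∑' k, ∫⁻ x, ‖g x‖ₑ * ∫⁻ y, ‖g y‖ₑ ∂((killed hA h ^ k) x) ∂π
        + (ξ / lam * ∫⁻ x, ‖g x‖ₑ ∂π)
          * ∑' k, ∫⁻ x, ‖g x‖ₑ * (killed hA h ^ k) x Set.univ ∂π) := by
  -- Truncations are bounded and dominated by `|g|`, so the two series for `g` bound theirs; only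
  -- the centering is lost.
  set t : ℕ → E → ℝ := fun K => {x | |g x| ≤ K}.indicator g with ht
  have htm : ∀ K, Measurable (t K) := fun K =>
    hg.indicator (measurableSet_le (by fun_prop) measurable_const)
  have htB : ∀ (K : ℕ) x, |t K x| ≤ K := fun K x => by
    by_cases hx : x ∈ {x | |g x| ≤ K}
    · rw [ht]; simp only [Set.indicator_of_mem hx]; exact hx
    · rw [ht]; simp only [Set.indicator_of_notMem hx, abs_zero]; positivity
  have hte : ∀ K x, ‖t K x‖ₑ ≤ ‖g x‖ₑ := fun K x => enorm_indicator_le_enorm_self _ _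
  have htl : ∀ x, ∀ᶠ K in Filter.atTop, t K x = g x := fun x => by
    obtain ⟨K₀, hK₀⟩ := exists_nat_ge |g x|
    filter_upwards [Filter.eventually_ge_atTop K₀] with K hK
    exact Set.indicator_of_mem (s := {x | |g x| ≤ K})
      (Set.mem_ofPred.2 (hK₀.trans (by exact_mod_cast hK))) _
  have hlim0 : Filter.Tendsto (fun K => ‖∫ x, t K x ∂π‖ₑ) Filter.atTop (nhds 0) := by
    have : Filter.Tendsto (fun K => ∫ x, t K x ∂π) Filter.atTop (nhds (∫ x, g x ∂π)) :=
      tendsto_integral_of_dominated_convergence (fun x => ‖g x‖)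
        (fun K => (htm K).aestronglyMeasurable) hgi.norm
        (fun K => .of_forall fun x => norm_indicator_le_norm_self _ _)
        (.of_forall fun x => tendsto_const_nhds.congr' ((htl x).mono fun K hK => hK.symm))
    rw [hg0] at this
    simpa using this.enorm
  set K₁ := ∑' k, ∫⁻ x, ‖g x‖ₑ * ∫⁻ y, ‖g y‖ₑ ∂((killed hA h ^ k) x) ∂π
  set K₂ := ∑' k, ∫⁻ x, ‖g x‖ₑ * (killed hA h ^ k) x Set.univ ∂π
  set β := ξ / lam * ∫⁻ x, ‖g x‖ₑ ∂π
  have hl : (lam : ℝ≥0∞) ≠ 0 := by simpa using hlam.ne'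
  have hβ : β ≠ ∞ := ENNReal.mul_ne_top (ENNReal.div_ne_top hξt hl) hgi.2.ne
  -- The centering error carries a factor of order `n ^ 2`, harmless because `n` is fixed as `K →
  -- ∞`. Its coefficient is finite since `ξ` and `π|g|` are.
  have hbd : ∀ K, ∫⁻ ω, ENNReal.ofReal ((∑ i ∈ Finset.Icc 1 n, t K (ω i)) ^ 2) ∂(chainLaw P π)
      ≤ 2 * n * (K₁ + β * K₂) + 2 * n * (β * n) * ‖∫ x, t K x ∂π‖ₑ := fun K => by
    refine (lintegral_sum_sq_le_of_bounded hπ hA h hlam hξ (htm K) (htB K) n).trans ?_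
    calc _ ≤ 2 * n * (K₁ + β * (n * ‖∫ x, t K x ∂π‖ₑ + K₂)) := by
          gcongr
          · exact ENNReal.tsum_le_tsum fun k => lintegral_mono fun x =>
              mul_le_mul' (hte K x) (lintegral_mono fun y => hte K y)
          · exact mul_le_mul' le_rfl (lintegral_mono fun x => hte K x)
          · exact ENNReal.tsum_le_tsum fun k => lintegral_mono fun x =>
              mul_le_mul' (hte K x) le_rfl
      _ = _ := by ring
  have hlim : Filter.Tendsto (fun K => 2 * n * (K₁ + β * K₂)
      + 2 * n * (β * n) * ‖∫ x, t K x ∂π‖ₑ) Filter.atTop (nhds (2 * n * (K₁ + β * K₂))) := by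
    have h1 := ENNReal.Tendsto.const_mul (a := 2 * n * (β * n)) hlim0 (Or.inr
      (ENNReal.mul_ne_top (ENNReal.mul_ne_top ENNReal.ofNat_ne_top (ENNReal.natCast_ne_top n))
        (ENNReal.mul_ne_top hβ (ENNReal.natCast_ne_top n))))
    simpa using tendsto_const_nhds.add h1
  have hpt : ∀ ω : ℕ → E, ENNReal.ofReal ((∑ i ∈ Finset.Icc 1 n, g (ω i)) ^ 2)
      = Filter.liminf (fun K => ENNReal.ofReal ((∑ i ∈ Finset.Icc 1 n, t K (ω i)) ^ 2))
        Filter.atTop := fun ω => by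
    refine (Filter.Tendsto.liminf_eq (tendsto_const_nhds.congr' ?_)).symm
    have : ∀ᶠ K in Filter.atTop, ∀ i ∈ Finset.Icc 1 n, t K (ω i) = g (ω i) :=
      (Filter.eventually_all_finset _).2 fun i _ => htl (ω i)
    filter_upwards [this] with K hK
    rw [Finset.sum_congr rfl hK]
  calc _ = ∫⁻ ω, Filter.liminf (fun K =>
          ENNReal.ofReal ((∑ i ∈ Finset.Icc 1 n, t K (ω i)) ^ 2)) Filter.atTop ∂(chainLaw P π) :=
        lintegral_congr hpt
    _ ≤ Filter.liminf (fun K => ∫⁻ ω,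
          ENNReal.ofReal ((∑ i ∈ Finset.Icc 1 n, t K (ω i)) ^ 2) ∂(chainLaw P π)) Filter.atTop :=
        lintegral_liminf_le fun K => by
          have := htm K
          fun_prop
    _ ≤ Filter.liminf (fun K => 2 * n * (K₁ + β * K₂)
          + 2 * n * (β * n) * ‖∫ x, t K x ∂π‖ₑ) Filter.atTop :=
        Filter.liminf_le_liminf (.of_forall hbd)
    _ = _ := hlim.liminf_eq

theorem enorm_sq_eq_ofReal (r : ℝ) : ‖r‖ₑ ^ 2 = ENNReal.ofReal (r ^ 2) := by
  rw [Real.enorm_eq_ofReal_abs, ← ENNReal.ofReal_pow (abs_nonneg r), sq_abs]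

/-- Needed for the convention `∞ · 0 = 0`: if `π(g²) = 0`, an infinite `ξ` does not make the
right-hand side infinite. -/
theorem lintegral_sum_sq_eq_zero (hπ : Kernel.Invariant P π) (hg : Measurable g)
    (h0 : ∫⁻ x, ENNReal.ofReal (g x ^ 2) ∂π = 0) (n : ℕ) :
    ∫⁻ ω, ENNReal.ofReal ((∑ i ∈ Finset.Icc 1 n, g (ω i)) ^ 2) ∂(chainLaw P π) = 0 := by
  have h1 : ∀ᵐ x ∂π, g x = 0 := by
    have := (lintegral_eq_zero_iff (by fun_prop)).1 h0
    filter_upwards [this] with x hx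
    simpa using hx
  have h2 : ∀ i, ∀ᵐ ω ∂(chainLaw P π), g (ω i) = 0 := fun i => by
    rw [← map_chainLaw_of_invariant hπ i] at h1
    exact ae_of_ae_map (measurable_pi_apply i).aemeasurable h1
  rw [lintegral_eq_zero_iff (by fun_prop)]
  filter_upwards [ae_all_iff.2 h2] with ω hω
  simp [hω]

end Main

end MarkovSplit

theorem theorem4 (p : ℝ) (hp : 2 < p) (lam : ℝ≥0) (hlam : 0 < lam) (α₀ : ℝ≥0∞) :
    ∃ C : ℝ≥0, 0 < C ∧
      ∀ (E : Type u) [MeasurableSpace E] (P : Kernel E E) [IsMarkovKernel P]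
        (A : Set E) (hA : MeasurableSet A) (ψ : Measure E) [IsProbabilityMeasure ψ]
        (hmin : Minorized P A ψ lam),
        (∀ x : E, ∀ᵐ ω ∂(chainLawAt P x), returnTime A ω < ⊤) →
        (⨆ x ∈ A, ∫⁻ ω, (returnTime A ω : ℝ≥0∞) ∂(chainLawAt P x)) < ∞ →
        atomMeanReturn hA hmin = α₀ →
        ∀ (π : Measure E) [IsProbabilityMeasure π], Kernel.Invariant P π →
        ∀ g : E → ℝ, Measurable g → Integrable g π → ∫ x, g x ∂π = 0 →
        ∀ n : ℕ, 1 ≤ n →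
          ∫⁻ ω, ENNReal.ofReal ((∑ i ∈ Finset.Icc 1 n, g (ω i)) ^ 2) ∂(chainLaw P π)
            ≤ n * C * (returnMoment P A p ^ 2 * ∫⁻ x, ENNReal.ofReal (g x ^ 2) ∂π
                + returnMoment P A p *
                  ∫⁻ ω, ENNReal.ofReal (g (ω 0) ^ 2) * (returnTime A ω : ℝ≥0∞) ^ p
                    ∂(chainLaw P π)) := by
  obtain ⟨q, rfl⟩ : ∃ q, p = q + 1 := ⟨p - 1, by ring⟩
  have hq1 : 1 < q := by linarith
  have hq : 0 ≤ q := by linarith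
  obtain ⟨C₁, hC₁⟩ := exists_tsum_polyWeight_killed_le.{u} hq hlam
  obtain ⟨Z, hZ⟩ : ∃ Z : ℝ≥0, (Z : ℝ≥0∞) = ∑' k, ((polyWeight q k : ℝ≥0∞))⁻¹ :=
    ⟨_, ENNReal.coe_toNNReal (tsum_inv_polyWeight_lt_top hq1).ne⟩
  -- The `2` counts each covariance twice; `C₁ + Z` comes from the first series (`hK₁`), the rest
  -- from the second (`hK₂`).
  refine ⟨2 * (C₁ + Z + lam⁻¹ * (2 * lam⁻¹ + (1 + Z))), by positivity, ?_⟩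
  intro E _ P _ A hA ψ _ hmin hret _ _ π _ hπ g hg hgi hg0 n hn
  set ξ := returnMoment P A (q + 1)
  obtain ⟨x₀⟩ : Nonempty E := nonempty_of_isProbabilityMeasure π
  have h1ξ : 1 ≤ ξ := one_le_returnMoment (by linarith) (hret x₀)
  have hC0 : (((2 * (C₁ + Z + lam⁻¹ * (2 * lam⁻¹ + (1 + Z))) : ℝ≥0)) : ℝ≥0∞) ≠ 0 := by
    rw [ne_eq, ENNReal.coe_eq_zero]
    positivity
  rcases eq_or_ne (∫⁻ x, ENNReal.ofReal (g x ^ 2) ∂π) 0 with hz | hz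
  · rw [lintegral_sum_sq_eq_zero hπ hg hz]; exact zero_le
  rcases eq_or_ne ξ ∞ with hξt | hξt
  · have hn0 : (n : ℝ≥0∞) ≠ 0 := by simpa using (by omega : n ≠ 0)
    rw [hξt, ENNReal.top_pow two_ne_zero, ENNReal.top_mul hz, top_add,
      ENNReal.mul_top (mul_ne_zero hn0 hC0)]
    exact le_top
  have hm : ∀ y ∈ A, ∑' k, polyWeight q k * (avoid P hA ^ k) y Set.univ ≤ ξ := fun y hy =>
    tsum_avoid_le_returnMoment hA hq hy
  have hr : ∀ y ∈ A, ∑' k, (avoid P hA ^ k) y Set.univ ≤ ξ := fun y hy => by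
    refine le_trans (ENNReal.tsum_le_tsum fun k => ?_) (hm y hy)
    exact le_mul_of_one_le_left zero_le (by exact_mod_cast one_le_polyWeight hq k)
  have hkac : 1 ≤ π A * ξ :=
    one_le_mul_of_tsum_avoid_le hA hπ hr fun x => tendsto_avoid_pow hA (hret x)
  have ha : ∀ k, polyWeight q k ≠ 0 := fun k =>
    (zero_lt_one.trans_le (one_le_polyWeight hq k)).ne'
  have hG : Measurable fun x => ‖g x‖ₑ := hg.enorm
  have hG2 : Measurable fun x => ‖g x‖ₑ ^ 2 := hG.pow_const 2
  set V := ∫⁻ x, ‖g x‖ₑ ^ 2 ∂π with hV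
  set m : E → ℝ≥0∞ := fun x => ∑' k, polyWeight q k * (avoid P hA ^ k) x Set.univ
  have hmm : Measurable m := Measurable.tsum fun k => (measurable_pow_univ _ k).const_mul _
  have hGm : Measurable fun x => ‖g x‖ₑ ^ 2 * m x := hG2.mul hmm
  set M := ∫⁻ x, ‖g x‖ₑ ^ 2 * m x ∂π with hM
  have hexc : π.bind (killed hA hmin) ≤ π := by
    refine Measure.le_iff.2 fun s hs => ?_
    conv_rhs => rw [← hπ.def]
    rw [Measure.bind_apply hs (Kernel.aemeasurable _), Measure.bind_apply hs (Kernel.aemeasurable _)]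
    exact lintegral_mono fun x => killed_le hA hmin x s
  have havoid : ∀ k x, (avoid P hA ^ k) x Set.univ ≤ 1 := fun k x => by
    have : IsProbabilityMeasure (chainLawAt P x) :=
      inferInstanceAs (IsProbabilityMeasure (chainLaw P (Measure.dirac x)))
    rw [avoid_pow_apply]; exact prob_le_one
  have hK₁ : ∑' k, ∫⁻ x, ‖g x‖ₑ * ∫⁻ y, ‖g y‖ₑ ∂((killed hA hmin ^ k) x) ∂π
      ≤ (C₁ + Z) * (ξ ^ 2 * V + ξ * M) := by
    refine (tsum_lintegral_mul_pow_le hexc hG (polyWeight q) ha).trans ?_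
    rw [← hZ]
    calc _ ≤ ∫⁻ x, ‖g x‖ₑ ^ 2 * (C₁ * (ξ ^ 2 + ξ * m x)) ∂π + Z * V := by
          gcongr with x
          exact hC₁ E P A hA ψ hmin ξ h1ξ hm x
      _ = C₁ * (ξ ^ 2 * V + ξ * M) + Z * V := by
          congr 1
          rw [hV, hM, ← lintegral_const_mul _ hG2, ← lintegral_const_mul _ hGm,
            ← lintegral_add_left (hG2.const_mul _),
            ← lintegral_const_mul' _ _ ENNReal.coe_ne_top]
          refine lintegral_congr fun x => ?_
          ring
      _ ≤ C₁ * (ξ ^ 2 * V + ξ * M) + Z * (ξ ^ 2 * V + ξ * M) := by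
          gcongr
          refine le_trans ?_ le_self_add
          exact le_mul_of_one_le_left zero_le (one_le_pow₀ h1ξ)
      _ = _ := by ring
  -- The prefactor uses up one power of `ξ`, so the lifetime is bounded to first order in `ξ`, and
  -- Young's inequality is applied to the powers of `avoid` only.
  have hK₂ : (ξ / lam * ∫⁻ x, ‖g x‖ₑ ∂π)
      * ∑' k, ∫⁻ x, ‖g x‖ₑ * (killed hA hmin ^ k) x Set.univ ∂π
      ≤ (lam : ℝ≥0∞)⁻¹ * (2 * (lam : ℝ≥0∞)⁻¹ + (1 + Z)) * (ξ ^ 2 * V + ξ * M) := by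
    have hsum : ∀ κ : Kernel E E, ∑' k, ∫⁻ x, ‖g x‖ₑ * (κ ^ k) x Set.univ ∂π
        = ∫⁻ x, ‖g x‖ₑ * ∑' k, (κ ^ k) x Set.univ ∂π := fun κ => by
      have hκ : ∀ k, Measurable fun x => ‖g x‖ₑ * (κ ^ k) x Set.univ := fun k =>
        hG.mul (measurable_pow_univ κ k)
      rw [← lintegral_tsum fun k => (hκ k).aemeasurable]
      simp only [ENNReal.tsum_mul_left]
    set I := ∫⁻ x, ‖g x‖ₑ ∂π with hI
    have h1 : ∑' k, ∫⁻ x, ‖g x‖ₑ * (killed hA hmin ^ k) x Set.univ ∂π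
        ≤ ξ / lam * I + ∑' k, ∫⁻ x, ‖g x‖ₑ * (avoid P hA ^ k) x Set.univ ∂π := by
      rw [hsum, hsum, hI, ← lintegral_const_mul _ hG, ← lintegral_add_left (hG.const_mul _)]
      refine lintegral_mono fun x => ?_
      calc _ ≤ ‖g x‖ₑ * (ξ / lam + ∑' k, (avoid P hA ^ k) x Set.univ) := by
            gcongr; exact tsum_killed_pow_le hA hmin hlam hr x
        _ = _ := by ring
    have h2 := tsum_lintegral_pow_mul_le (π := π) havoid hG (polyWeight q) ha
    rw [← hZ] at h2
    have h3 : I ^ 2 ≤ 2 * V := sq_lintegral_le hG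
    set R := ∑' k, ∫⁻ x, ‖g x‖ₑ * (avoid P hA ^ k) x Set.univ ∂π
    rw [ENNReal.div_eq_inv_mul] at *
    calc _ ≤ ((lam : ℝ≥0∞)⁻¹ * ξ * I) * ((lam : ℝ≥0∞)⁻¹ * ξ * I + R) := by gcongr
      _ = (lam : ℝ≥0∞)⁻¹ * ((lam : ℝ≥0∞)⁻¹ * ξ ^ 2 * I ^ 2 + ξ * (R * I)) := by ring
      _ ≤ (lam : ℝ≥0∞)⁻¹ * ((lam : ℝ≥0∞)⁻¹ * ξ ^ 2 * (2 * V) + ξ * (M + Z * V)) := by gcongr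
      _ = (lam : ℝ≥0∞)⁻¹ * ((2 * (lam : ℝ≥0∞)⁻¹) * (ξ ^ 2 * V) + ξ * M + Z * (ξ * V)) := by ring
      _ ≤ (lam : ℝ≥0∞)⁻¹ * ((2 * (lam : ℝ≥0∞)⁻¹) * (ξ ^ 2 * V + ξ * M) + (ξ ^ 2 * V + ξ * M)
            + Z * (ξ ^ 2 * V + ξ * M)) := by
          gcongr
          · exact le_self_add
          · exact le_add_self
          · refine le_trans ?_ le_self_add
            gcongr
            exact le_self_pow₀ h1ξ two_ne_zero
      _ = _ := by ring
  have hMle : M ≤ ∫⁻ ω, ‖g (ω 0)‖ₑ ^ 2 * (returnTime A ω : ℝ≥0∞) ^ (q + 1) ∂(chainLaw P π) :=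
    lintegral_mul_tsum_avoid_le hA π hG2 hq
  have hcoe : (((2 * (C₁ + Z + lam⁻¹ * (2 * lam⁻¹ + (1 + Z))) : ℝ≥0)) : ℝ≥0∞)
      = 2 * (C₁ + Z + (lam : ℝ≥0∞)⁻¹ * (2 * (lam : ℝ≥0∞)⁻¹ + (1 + Z))) := by
    rw [← ENNReal.coe_inv hlam.ne']
    push_cast
    rfl
  rw [hcoe]
  simp only [← enorm_sq_eq_ofReal]
  calc _ = ∫⁻ ω, ENNReal.ofReal ((∑ i ∈ Finset.Icc 1 n, g (ω i)) ^ 2) ∂(chainLaw P π) := by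
        simp only [enorm_sq_eq_ofReal]
    _ ≤ _ := lintegral_sum_sq_le hπ hA hmin hlam hkac hξt hg hgi hg0 n
    _ ≤ 2 * n * ((C₁ + Z) * (ξ ^ 2 * V + ξ * M)
          + (lam : ℝ≥0∞)⁻¹ * (2 * (lam : ℝ≥0∞)⁻¹ + (1 + Z)) * (ξ ^ 2 * V + ξ * M)) := by gcongr
    _ = n * (2 * (C₁ + Z + (lam : ℝ≥0∞)⁻¹ * (2 * (lam : ℝ≥0∞)⁻¹ + (1 + Z))))
          * (ξ ^ 2 * V + ξ * M) := by ring
    _ ≤ _ := by gcongr
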